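/- Let $\mathbb{K}$ be an algebraically closed field of characteristic zero, $N$ a lattice of finite rank, $M=\operatorname{Hom}(N,\mathbb{Z})$, $\langle\cdot,\cdot\rangle$ the natural pairing, $\sigma\subseteq N_{\mathbb{Q}}$ a strongly convex polyhedral cone, and $S_\sigma=M\cap\sigma^\vee$. Let $X=X_\sigma=\operatorname{Spec}\mathbb{K}[S_\sigma]$, $\mathbb{K}[S_\sigma]=\bigoplus_{u\in S_\sigma}\mathbb{K}\chi^u$, be the corresponding affine toric variety, with acting torus $\mathbb{T}=\operatorname{Hom}(M,\mathbb{K}^\times)$. Let $p\in N$ be the primitive vector on a ray $\rho$ of $\sigma$, and let $e_1,e_2\in M$ be Demazure roots corresponding to $p$, i.e. $\langle p,e_k\rangle=-1$ and $\langle q,e_k\rangle\ge 0$ for the primitive vectors $q$ on all other rays of $\sigma$ ($k=1,2$). Consider on $X$ the monoid structure $*$ with the comultiplication $$\chi^u\mapsto \chi^u\otimes\chi^u\,(1\otimes\chi^{e_1}+\chi^{e_2}\otimes 1)^{\langle p,u\rangle},\qquad u\in S_\sigma,$$ (every affine monoid of corank one is of this form). Let $G$ be the group of invertible elements of $X$,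 acting together with a second copy of itself on $X$ by $(g,h)\cdot x=g*x*h^{-1}$, and let $E(X)=\{x\in X\mid x*x=x\}$. For a face $\tau$ of $\sigma$ let $x_\tau\in X$ be the point with $\chi^u(x_\tau)=1$ for $u\in\tau^\perp$ and $\chi^u(x_\tau)=0$ for the other $u\in S_\sigma$, let $O_\tau=\mathbb{T}x_\tau$, and let $E_\tau=E(X)\cap O_\tau$. Closures and irreducible components are taken in the Zariski topology. (a) For any face $\gamma$ of $\sigma$ such that $\rho$ is not a ray of $\gamma$ and exactly one of $e_1,e_2$ belongs to $\gamma^\perp$, $$\overline{E_\gamma}=E_\gamma\cup\{x_{\operatorname{cone}(\gamma,\rho)}\}.$$ (b) The irreducible components of $E(X)$ are pairwise disjoint, and each of them is either a point or isomorphic to the affine line. (c) Any irreducible component of $E(X)$ is contained in a $(G\times G)$-orbit, and any $(G\times G)$-orbit contains at most one irreducible component of $E(X)$. -/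

import Mathlib

open scoped TensorProduct

namespace ToricMonoid

section Cones

variable {N : Type*} [AddCommGroup N]

/-- The rational vector space `N_ℚ = ℚ ⊗ N` of a lattice `N`. The dual lattice `M` is
`Module.Dual ℤ N`, and `M_ℚ` is `Module.Dual ℚ (NQ N)`. -/
abbrev NQ (N : Type*) [AddCommGroup N] : Type _ := ℚ ⊗[ℤ] N

/-- The pairing `⟨·, u⟩ : N_ℚ → ℚ` with `u ∈ M`, i.e. the image of `u` in `M_ℚ`. -/
noncomputable def pairQ (u : Module.Dual ℤ N) : Module.Dual ℚ (NQ N) :=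
  LinearMap.liftBaseChange ℚ ((Algebra.linearMap ℤ ℚ).comp u)

@[simp] theorem pairQ_tmul (u : Module.Dual ℤ N) (a : ℚ) (v : N) :
    pairQ u (a ⊗ₜ[ℤ] v) = a * (u v : ℚ) := by
  simp [pairQ]

theorem pairQ_add (u w : Module.Dual ℤ N) : pairQ (u + w) = pairQ u + pairQ w := by
  ext v; simp [pairQ]

@[simp] theorem pairQ_zero : pairQ (0 : Module.Dual ℤ N) = 0 := by
  ext v; simp [pairQ]

/-- The cone `ℚ_{≥0} p` generated by a lattice vector `p`. -/
noncomputable def ray (p : N) : PointedCone ℚ (NQ N) :=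
  PointedCone.hull ℚ {(1 : ℚ) ⊗ₜ[ℤ] p}

/-- `τ` is a face of `σ`: the intersection of `σ` with a supporting hyperplane `f = 0`, where
`f ∈ σ^∨` (for `f = 0` this is `σ` itself). -/
def IsFace (τ σ : PointedCone ℚ (NQ N)) : Prop :=
  ∃ f : Module.Dual ℚ (NQ N), (∀ v ∈ σ, 0 ≤ f v) ∧ ∀ v, v ∈ τ ↔ v ∈ σ ∧ f v = 0

theorem IsFace.le {τ σ : PointedCone ℚ (NQ N)} (h : IsFace τ σ) : τ ≤ σ := by
  obtain ⟨f, -, hf⟩ := h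
  exact fun v hv => ((hf v).1 hv).1

/-- A ray of `σ` is a one-dimensional face of `σ`. -/
def IsRay (ρ σ : PointedCone ℚ (NQ N)) : Prop :=
  IsFace ρ σ ∧ Module.finrank ℚ (Submodule.span ℚ (ρ : Set (NQ N))) = 1

/-- A lattice vector is primitive if it is not a proper integer multiple of a lattice vector
(in particular it is nonzero). -/
def IsPrimitive (p : N) : Prop := ∀ (k : ℤ) (q : N), p = k • q → IsUnit k

/-- `p` is the primitive vector on a ray of `σ`. -/
def IsPrimitiveOnRay (σ : PointedCone ℚ (NQ N)) (p : N) : Prop :=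
  IsPrimitive p ∧ IsRay (ray p) σ

/-- `e ∈ M` is a Demazure root of `σ` corresponding to the primitive vector `p` on a ray:
`⟨p, e⟩ = -1` and `⟨q, e⟩ ≥ 0` for the primitive vectors `q` on all other rays. -/
def IsDemazureRoot (σ : PointedCone ℚ (NQ N)) (p : N) (e : Module.Dual ℤ N) : Prop :=
  e p = -1 ∧ ∀ q : N, IsPrimitiveOnRay σ q → q ≠ p → 0 ≤ e q

/-- `e ∈ γ^⊥`. -/
def InPerp (e : Module.Dual ℤ N) (γ : PointedCone ℚ (NQ N)) : Prop := ∀ v ∈ γ, pairQ e v = 0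

/-- Auxiliary form of the lemma of Farkas. -/
theorem farkas_aux {V ι : Type*} [AddCommGroup V] [Module ℚ V] (s : Finset ι) :
    ∀ (a : ι → Module.Dual ℚ V) (b : Module.Dual ℚ V),
      (∀ x, (∀ i ∈ s, a i x ≤ 0) → b x ≤ 0) →
      ∃ c : ι → ℚ, (∀ i, 0 ≤ c i) ∧ b = ∑ i ∈ s, c i • a i := by
  classical
  induction s using Finset.induction_on with
  | empty =>
    intro a b h
    refine ⟨fun _ => 0, fun _ => le_rfl, ?_⟩
    ext x
    have h1 := h x (by simp)
    have h2 := h (-x) (by simp)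
    simp only [map_neg] at h2
    simp; linarith
  | insert k s hk ih =>
    intro a b h
    by_cases h0 : ∀ x, (∀ i ∈ s, a i x ≤ 0) → b x ≤ 0
    · obtain ⟨c, hc, hb⟩ := ih a b h0
      refine ⟨fun i => if i = k then 0 else c i, fun i => ?_, ?_⟩
      · dsimp only; split_ifs; exacts [le_rfl, hc i]
      · rw [Finset.sum_insert hk, hb]
        simp only [if_true, zero_smul, zero_add]
        refine Finset.sum_congr rfl fun i hi => ?_
        rw [if_neg (by rintro rfl; exact hk hi)]
    · push Not at h0
      obtain ⟨y, hy, hby⟩ := h0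
      have hky : 0 < a k y := by
        by_contra hcon
        push Not at hcon
        refine absurd (h y fun i hi => ?_) (not_le.2 hby)
        rcases Finset.mem_insert.1 hi with rfl | hi
        exacts [hcon, hy i hi]
      obtain ⟨c, hc, hb⟩ := ih (fun i => a i - (a i y / a k y) • a k) (b - (b y / a k y) • a k) (by
        intro x hx
        have := h (x - (a k x / a k y) • y) (by
          intro i hi
          rcases Finset.mem_insert.1 hi with rfl | hi
          · simp [hky.ne']
          · have := hx i hi
            simp only [LinearMap.sub_apply, LinearMap.smul_apply, smul_eq_mul, map_sub,
              map_smul] at this ⊢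
            have e : a i y / a k y * a k x = a k x / a k y * a i y := by ring
            linarith)
        simp only [LinearMap.sub_apply, LinearMap.smul_apply, smul_eq_mul, map_sub,
              map_smul] at this ⊢
        have e : b y / a k y * a k x = a k x / a k y * b y := by ring
        linarith)
      refine ⟨fun i => if i = k then b y / a k y - ∑ i ∈ s, c i * (a i y / a k y) else c i,
        fun i => ?_, ?_⟩
      · dsimp only; split_ifs
        · have : ∑ i ∈ s, c i * (a i y / a k y) ≤ 0 :=
            Finset.sum_nonpos fun i hi =>
              mul_nonpos_of_nonneg_of_nonpos (hc i)
                (div_nonpos_of_nonpos_of_nonneg (hy i hi) hky.le)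
          have := div_pos hby hky
          linarith
        · exact hc i
      · rw [Finset.sum_insert hk]
        simp only [if_true]
        have e : ∑ i ∈ s, (if i = k then b y / a k y - ∑ i ∈ s, c i * (a i y / a k y) else c i) • a i
            = ∑ i ∈ s, c i • a i := by
          refine Finset.sum_congr rfl fun i hi => ?_
          rw [if_neg (by rintro rfl; exact hk hi)]
        rw [e, sub_smul, Finset.sum_smul]
        have hb' := hb
        simp only [smul_sub, Finset.sum_sub_distrib, smul_smul] at hb'
        rw [sub_eq_iff_eq_add] at hb'
        refine hb'.trans ?_
        abel

/-- The lemma of Farkas over `ℚ`. -/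
theorem farkas {V ι : Type*} [AddCommGroup V] [Module ℚ V] (s : Finset ι) (v : ι → V) (x : V)
    (h : ∀ f : Module.Dual ℚ V, (∀ i ∈ s, 0 ≤ f (v i)) → 0 ≤ f x) :
    ∃ c : ι → ℚ, (∀ i, 0 ≤ c i) ∧ x = ∑ i ∈ s, c i • v i := by
  obtain ⟨c, hc, hb⟩ := farkas_aux s (fun i => Module.Dual.eval ℚ V (v i)) (Module.Dual.eval ℚ V x)
    (fun f hf => by
      have := h (-f) (by simpa using hf)
      simpa using this)
  refine ⟨c, hc, Module.eval_apply_injective ℚ (V := V) ?_⟩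
  rw [hb]; simp [map_sum]

/-- Every nonzero rational vector is a positive multiple of a primitive lattice vector. -/
theorem exists_primitive [Module.Free ℤ N] [Module.Finite ℤ N] (v : NQ N) (hv : v ≠ 0) :
    ∃ (p : N) (c : ℚ), IsPrimitive p ∧ 0 < c ∧ v = c • ((1 : ℚ) ⊗ₜ[ℤ] p) := by
  classical
  have h1 : ∃ (n : ℕ) (q : N), 0 < n ∧ (n : ℚ) • v = (1 : ℚ) ⊗ₜ[ℤ] q := by
    clear hv
    induction v using TensorProduct.induction_on with
    | zero => exact ⟨1, 0, one_pos, by simp⟩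
    | tmul a x =>
      refine ⟨a.den, a.num • x, a.den_pos, ?_⟩
      rw [TensorProduct.smul_tmul', smul_eq_mul, Rat.den_mul_eq_num, ← TensorProduct.smul_tmul]
      simp
    | add x y hx hy =>
      obtain ⟨n, q, hn, hq⟩ := hx
      obtain ⟨m, r, hm, hr⟩ := hy
      refine ⟨n * m, (m : ℤ) • q + (n : ℤ) • r, Nat.mul_pos hn hm, ?_⟩
      rw [TensorProduct.tmul_add, TensorProduct.tmul_smul, TensorProduct.tmul_smul, ← hq, ← hr,
        smul_add]
      congr 1
      · push_cast; rw [mul_comm, mul_smul]; simp [Nat.cast_smul_eq_nsmul]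
      · push_cast; rw [mul_smul]; simp [Nat.cast_smul_eq_nsmul]
  obtain ⟨n, q, hn, hq⟩ := h1
  have hn' : (0 : ℚ) < n := by exact_mod_cast hn
  have hq0 : q ≠ 0 := by
    rintro rfl
    rw [TensorProduct.tmul_zero] at hq
    rcases smul_eq_zero.1 hq with h | h
    exacts [hn'.ne' h, hv h]
  let b := Module.Free.chooseBasis ℤ N
  have hex : ∃ i, b.repr q i ≠ 0 := by
    by_contra hcon
    push Not at hcon
    exact hq0 (b.repr.map_eq_zero_iff.1 (Finsupp.ext hcon))
  obtain ⟨i₀, hi₀⟩ := hex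
  obtain ⟨g, hg, hg1⟩ := Finset.extract_gcd (fun i => b.repr q i)
    (s := Finset.univ) ⟨i₀, Finset.mem_univ _⟩
  set d := Finset.univ.gcd fun i => b.repr q i with hd
  have hd0 : d ≠ 0 := fun h => hi₀ (by rw [hg i₀ (Finset.mem_univ _), h, zero_mul])
  have hdpos : 0 < d := lt_of_le_of_ne (by
    have : normalize d = d := Finset.normalize_gcd
    rw [← this, ← Int.abs_eq_normalize]
    exact abs_nonneg _) hd0.symm
  let p : N := ∑ i, g i • b i
  have hp : ∀ i, b.repr p i = g i := by
    intro i
    have := congrFun (congrArg (fun f => (f : _ → ℤ)) (b.repr_sum_self g)) i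
    exact this
  have hqp : q = d • p := by
    apply b.repr.injective
    ext i
    rw [map_smul, Finsupp.smul_apply, hp, smul_eq_mul, hg i (Finset.mem_univ _)]
  refine ⟨p, d / n, ?_, by positivity, ?_⟩
  · intro k r hr
    have : k ∣ Finset.univ.gcd g := Finset.dvd_gcd fun i _ => by
      rw [← hp i, hr, map_smul, Finsupp.smul_apply, smul_eq_mul]
      exact dvd_mul_right _ _
    rw [hg1] at this
    exact isUnit_of_dvd_one this
  · have : v = (n : ℚ)⁻¹ • ((n : ℚ) • v) := by rw [smul_smul, inv_mul_cancel₀ hn'.ne', one_smul]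
    rw [this, hq, hqp, TensorProduct.tmul_smul, ← Int.cast_smul_eq_zsmul ℚ, smul_smul]
    congr 1
    field_simp

theorem mem_hull_finset {V : Type*} [AddCommGroup V] [Module ℚ V] {s : Finset V} {x : V} :
    x ∈ PointedCone.hull ℚ (s : Set V) ↔ ∃ c : V → ℚ, (∀ i, 0 ≤ c i) ∧ x = ∑ i ∈ s, c i • i := by
  constructor
  · intro hx
    obtain ⟨c, -, hc⟩ := Submodule.mem_span_finset.1 hx
    exact ⟨fun i => c i, fun i => (c i).2, hc.symm⟩
  · rintro ⟨c, hc, rfl⟩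
    exact Submodule.sum_mem _ fun i hi =>
      PointedCone.smul_mem _ (hc i) (Submodule.subset_span hi)

/-- A strongly convex polyhedral cone is generated by the primitive vectors on its rays. -/
theorem exists_rays [Module.Free ℤ N] [Module.Finite ℤ N] {σ : PointedCone ℚ (NQ N)}
    (hfg : σ.FG) (hsal : (σ : ConvexCone ℚ (NQ N)).Salient) :
    ∃ s : Finset (NQ N), PointedCone.hull ℚ (s : Set (NQ N)) = σ ∧
      ∀ v ∈ s, ∃ (p : N) (c : ℚ), IsPrimitiveOnRay σ p ∧ 0 < c ∧ v = c • ((1 : ℚ) ⊗ₜ[ℤ] p) := by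
  classical
  have hex : ∃ n : ℕ, ∃ s : Finset (NQ N), s.card = n ∧ PointedCone.hull ℚ (s : Set (NQ N)) = σ := by
    obtain ⟨s, hs⟩ := hfg
    exact ⟨_, s, rfl, hs⟩
  obtain ⟨s, hcard, hs⟩ := Nat.find_spec hex
  have hmin : ∀ v ∈ s, v ∉ PointedCone.hull ℚ (s.erase v : Set (NQ N)) := by
    intro v hv hcon
    refine Nat.find_min hex (m := (s.erase v).card) ?_ ⟨s.erase v, rfl, ?_⟩
    · rw [← hcard]; exact Finset.card_erase_lt_of_mem hv
    · rw [← hs]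
      refine le_antisymm (Submodule.span_mono (by simp)) (Submodule.span_le.2 fun w hw => ?_)
      by_cases hwv : w = v
      · exact hwv ▸ hcon
      · exact Submodule.subset_span (by simpa [hwv] using hw)
  have hne : ∀ v ∈ s, v ≠ 0 := by
    rintro v hv rfl
    exact hmin 0 hv (Submodule.zero_mem _)
  have hmem : ∀ v ∈ s, v ∈ σ := fun v hv => hs ▸ Submodule.subset_span hv
  refine ⟨s, hs, fun v hv => ?_⟩
  have hsep : ∀ w ∈ s.erase v, ∃ f : Module.Dual ℚ (NQ N),
      (∀ i ∈ s, 0 ≤ f i) ∧ f v = 0 ∧ 0 < f w := by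
    intro w hw
    by_contra hcon
    push Not at hcon
    obtain ⟨c, hc, he⟩ := farkas (Finset.insertNone s)
      (fun o => o.elim (-v) id) (-w) (by
        intro f hf
        have h1 : ∀ i ∈ s, 0 ≤ f i := fun i hi => hf (some i) (by simpa using hi)
        have h2 : 0 ≤ f (-v) := hf none (by simp)
        rw [map_neg] at h2 ⊢
        have := hcon f h1 (le_antisymm (by linarith) (h1 v hv))
        linarith)
    rw [Finset.sum_insertNone, ← Finset.add_sum_erase s _ hv] at he
    simp only [Option.elim_none, Option.elim_some, id] at he
    set T := ∑ i ∈ s.erase v, c (some i) • i with hT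
    have hTm : T ∈ PointedCone.hull ℚ (s.erase v : Set (NQ N)) := by
      refine Submodule.sum_mem _ fun i hi => PointedCone.smul_mem _ (hc _) (Submodule.subset_span hi)
    have hwm : w ∈ PointedCone.hull ℚ (s.erase v : Set (NQ N)) := Submodule.subset_span hw
    have hTσ : T ∈ σ := hs ▸ Submodule.span_mono (by simp) hTm
    have hws : w ∈ s := Finset.mem_of_mem_erase hw
    have he' : w + T = (c none - c (some v)) • v := by
      rw [sub_smul]
      have : w = -(c none • -v + (c (some v) • v + T)) := by rw [← he]; simp
      rw [this]
      simp only [smul_neg]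
      abel
    rcases lt_or_ge 0 (c none - c (some v)) with hd | hd
    · refine hmin v hv ?_
      have h1 := PointedCone.smul_mem _ (inv_nonneg.2 hd.le) (Submodule.add_mem _ hwm hTm)
      rwa [he', smul_smul, inv_mul_cancel₀ hd.ne', one_smul] at h1
    · refine hsal w (hmem w hws) (hne w hws) ?_
      have : -w = T + (-(c none - c (some v))) • v := by
        rw [neg_smul, ← he']; abel
      rw [this]
      exact Submodule.add_mem σ hTσ (PointedCone.smul_mem _ (by linarith) (hmem v hv))
  choose! F hF1 hF2 hF3 using hsep
  obtain ⟨p, c, hp, hc, hvp⟩ := exists_primitive v (hne v hv)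
  have hray : PointedCone.hull ℚ {v} = ray p := by
    refine le_antisymm (Submodule.span_le.2 ?_) (Submodule.span_le.2 ?_)
    · rintro _ rfl
      rw [hvp]
      exact PointedCone.smul_mem _ hc.le (Submodule.subset_span rfl)
    · rintro _ rfl
      have : (1 : ℚ) ⊗ₜ[ℤ] p = c⁻¹ • v := by rw [hvp, smul_smul, inv_mul_cancel₀ hc.ne', one_smul]
      rw [this]
      exact PointedCone.smul_mem _ (inv_nonneg.2 hc.le) (Submodule.subset_span rfl)
  refine ⟨p, c, ⟨hp, ?_, ?_⟩, hc, hvp⟩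
  · rw [← hray]
    have hf0 : ∀ i ∈ s, 0 ≤ (∑ w ∈ s.erase v, F w) i := fun i hi => by
      rw [LinearMap.sum_apply]
      exact Finset.sum_nonneg fun w hw => hF1 w hw i hi
    have hfpos : ∀ i ∈ s.erase v, 0 < (∑ w ∈ s.erase v, F w) i := fun i hi => by
      rw [LinearMap.sum_apply]
      exact Finset.sum_pos' (fun w hw => hF1 w hw i (Finset.mem_of_mem_erase hi))
        ⟨i, hi, hF3 i hi⟩
    have hfv : (∑ w ∈ s.erase v, F w) v = 0 := by
      rw [LinearMap.sum_apply]
      exact Finset.sum_eq_zero fun w hw => hF2 w hw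
    refine ⟨∑ w ∈ s.erase v, F w, ?_, ?_⟩
    · intro x hx
      rw [← hs] at hx
      obtain ⟨a, ha, rfl⟩ := mem_hull_finset.1 hx
      rw [map_sum]
      exact Finset.sum_nonneg fun i hi => by
        rw [map_smul]; exact mul_nonneg (ha i) (hf0 i hi)
    · intro x
      constructor
      · intro hx
        have hx' := hx
        rw [← Finset.coe_singleton] at hx'
        obtain ⟨a, ha, rfl⟩ := mem_hull_finset.1 hx'
        rw [Finset.sum_singleton]
        exact ⟨PointedCone.smul_mem _ (ha v) (hmem v hv), by rw [map_smul, hfv, smul_zero]⟩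
      · rintro ⟨hx, hfx⟩
        rw [← hs] at hx
        obtain ⟨a, ha, rfl⟩ := mem_hull_finset.1 hx
        rw [map_sum, Finset.sum_eq_zero_iff_of_nonneg (fun i hi => by
          rw [map_smul]; exact mul_nonneg (ha i) (hf0 i hi))] at hfx
        rw [Finset.sum_eq_single v]
        · exact PointedCone.smul_mem _ (ha v) (Submodule.subset_span rfl)
        · intro i hi hiv
          have h1 := hfx i hi
          rw [map_smul, smul_eq_mul] at h1
          rcases mul_eq_zero.1 h1 with h | h
          · rw [h, zero_smul]
          · exact absurd h (hfpos i (Finset.mem_erase.2 ⟨hiv, hi⟩)).ne'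
        · exact fun h => absurd hv h
  · rw [← hray]
    have : Submodule.span ℚ (PointedCone.hull ℚ {v} : Set (NQ N)) = Submodule.span ℚ {v} :=
      Submodule.span_span_of_tower _ _ _
    rw [this, finrank_span_singleton (hne v hv)]

/-- A lattice functional that is nonnegative on the primitive vectors of all rays of a strongly
convex polyhedral cone is nonnegative on the cone. -/
theorem nonneg_of_nonneg_on_rays [Module.Free ℤ N] [Module.Finite ℤ N]
    {σ : PointedCone ℚ (NQ N)} (hfg : σ.FG) (hsal : (σ : ConvexCone ℚ (NQ N)).Salient)
    (u : Module.Dual ℤ N) (hu : ∀ q : N, IsPrimitiveOnRay σ q → 0 ≤ u q) :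
    ∀ v ∈ σ, 0 ≤ pairQ u v := by
  obtain ⟨s, hs, hr⟩ := exists_rays hfg hsal
  intro v hv
  rw [← hs] at hv
  obtain ⟨a, ha, rfl⟩ := mem_hull_finset.1 hv
  rw [map_sum]
  refine Finset.sum_nonneg fun i hi => ?_
  obtain ⟨p, c, hp, hc, rfl⟩ := hr i hi
  rw [map_smul, map_smul, pairQ_tmul, one_mul]
  have : (0 : ℚ) ≤ u p := by exact_mod_cast hu p hp
  exact mul_nonneg (ha _) (mul_nonneg hc.le this)

end Cones

/-- The combinatorial data `(σ, p, e₁, e₂)` of a corank one affine monoid structure on an affine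
toric variety: a strongly convex polyhedral cone `σ` in `N_ℚ`, the primitive vector `p` on a ray `ρ`
of `σ`, and two Demazure roots `e₁, e₂` corresponding to `p`. -/
structure CorankOneDatum (N : Type*) [AddCommGroup N] where
  σ : PointedCone ℚ (NQ N)
  fg : σ.FG
  salient : (σ : ConvexCone ℚ (NQ N)).Salient
  p : N
  primitive_p : IsPrimitiveOnRay σ p
  e₁ : Module.Dual ℤ N
  e₂ : Module.Dual ℤ N
  root₁ : IsDemazureRoot σ p e₁
  root₂ : IsDemazureRoot σ p e₂

theorem fst_le_of_mem {n : ℕ} {ij : ℕ × ℕ} (h : ij ∈ Finset.HasAntidiagonal.antidiagonal (n)) :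
    ij.1 ≤ n := by
  have := Finset.HasAntidiagonal.mem_antidiagonal.1 h
  omega

theorem snd_le_of_mem {n : ℕ} {ij : ℕ × ℕ} (h : ij ∈ Finset.HasAntidiagonal.antidiagonal (n)) :
    ij.2 ≤ n := by
  have := Finset.HasAntidiagonal.mem_antidiagonal.1 h
  omega

namespace CorankOneDatum

section Lattice

variable {N : Type*} [AddCommGroup N] (D : CorankOneDatum N)

/-- The ray `ρ` of `σ` with primitive vector `p`. -/
noncomputable def ρ : PointedCone ℚ (NQ N) := ray D.p

/-- The semigroup `S_σ = M ∩ σ^∨`. -/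
def S : AddSubmonoid (Module.Dual ℤ N) where
  carrier := {u | ∀ v ∈ D.σ, 0 ≤ pairQ u v}
  zero_mem' := fun v _ => by simp
  add_mem' := fun {a b} ha hb v hv => by
    rw [pairQ_add, LinearMap.add_apply]
    exact add_nonneg (ha v hv) (hb v hv)

variable {D}

theorem mem_S {u : Module.Dual ℤ N} : u ∈ D.S ↔ ∀ v ∈ D.σ, 0 ≤ pairQ u v := Iff.rfl

theorem S_nonneg {u : Module.Dual ℤ N} (hu : u ∈ D.S) {q : N} (hq : IsPrimitiveOnRay D.σ q) :
    0 ≤ u q := by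
  have h : (1 : ℚ) ⊗ₜ[ℤ] q ∈ D.σ := hq.2.1.le (Submodule.subset_span rfl)
  have := hu _ h
  rw [pairQ_tmul, one_mul] at this
  exact_mod_cast this

variable (D)

/-- The number `⟨p, u⟩` (nonnegative for `u ∈ S_σ`). -/
def deg (u : Module.Dual ℤ N) : ℕ := (u D.p).toNat

variable {D}

theorem deg_cast {u : Module.Dual ℤ N} (hu : u ∈ D.S) : (D.deg u : ℤ) = u D.p :=
  Int.toNat_of_nonneg (S_nonneg hu D.primitive_p)

theorem deg_add {u w : Module.Dual ℤ N} (hu : u ∈ D.S) (hw : w ∈ D.S) :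
    D.deg (u + w) = D.deg u + D.deg w := by
  have h1 := deg_cast hu
  have h2 := deg_cast hw
  have h3 := deg_cast (D.S.add_mem hu hw)
  rw [LinearMap.add_apply] at h3
  omega

/-- `u + i e ∈ S_σ` for `u ∈ S_σ`, a Demazure root `e` corresponding to `p`, `0 ≤ i ≤ ⟨p, u⟩`. -/
theorem shift_mem [Module.Free ℤ N] [Module.Finite ℤ N] {e : Module.Dual ℤ N}
    (he : IsDemazureRoot D.σ D.p e) {u : Module.Dual ℤ N} (hu : u ∈ D.S) {i : ℕ}
    (hi : i ≤ D.deg u) : u + i • e ∈ D.S := by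
  refine nonneg_of_nonneg_on_rays D.fg D.salient _ fun q hq => ?_
  rw [LinearMap.add_apply, LinearMap.smul_apply]
  by_cases hqp : q = D.p
  · rw [hqp, he.1, ← deg_cast hu]; simp; exact hi
  · have h1 := he.2 q hq hqp
    have h2 := S_nonneg hu hq
    positivity

theorem deg_shift {e : Module.Dual ℤ N}
    (he : IsDemazureRoot D.σ D.p e) {u : Module.Dual ℤ N} (hu : u ∈ D.S) (i : ℕ) :
    D.deg (u + i • e) = D.deg u - i := by
  have := deg_cast hu
  unfold deg at *
  rw [LinearMap.add_apply, LinearMap.smul_apply, he.1]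
  simp only [smul_neg, nsmul_eq_mul, mul_one]
  omega

end Lattice

variable (K : Type*) [Field K] {N : Type*} [AddCommGroup N] (D : CorankOneDatum N)

/-- The algebra `K[X] = K[S_σ] = ⨁ K χ^u` of regular functions on `X = X_σ`. -/
abbrev Coord : Type _ := AddMonoidAlgebra K D.S

/-- `χ^u ∈ K[S_σ]`, `u ∈ S_σ`. -/
noncomputable def chi (u : D.S) : Coord K D := AddMonoidAlgebra.single u 1

/-- The group algebra `K[M]`. -/
abbrev TorusCoord (K : Type*) [Field K] (N : Type*) [AddCommGroup N] : Type _ :=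
  AddMonoidAlgebra K (Module.Dual ℤ N)

/-- `χ^u ∈ K[M]`. -/
noncomputable def chiM (u : Module.Dual ℤ N) : TorusCoord K N := AddMonoidAlgebra.single u 1

/-- The inclusion `K[S_σ] ⊆ K[M]`. -/
noncomputable def incl : Coord K D →ₐ[K] TorusCoord K N :=
  AddMonoidAlgebra.mapDomainAlgHom K K D.S.subtype

theorem incl_chi (u : D.S) : incl K D (chi K D u) = chiM K (u : Module.Dual ℤ N) := by
  simp [incl, chi, chiM]

theorem chiM_add (u w : Module.Dual ℤ N) : chiM K (u + w) = chiM K u * chiM K w := by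
  simp [chiM, AddMonoidAlgebra.single_mul_single]

theorem chiM_zero : chiM K (0 : Module.Dual ℤ N) = 1 := rfl

theorem chiM_nsmul (i : ℕ) (u : Module.Dual ℤ N) : chiM K (i • u) = chiM K u ^ i := by
  simp [chiM, AddMonoidAlgebra.single_pow]

theorem incl_injective : Function.Injective (incl K D) :=
  AddMonoidAlgebra.mapDomain_injective Subtype.val_injective

theorem map_incl_injective :
    Function.Injective (Algebra.TensorProduct.map (incl K D) (incl K D)) :=
  TensorProduct.map_injective_of_flat_flat (incl K D).toLinearMap (incl K D).toLinearMap
    (incl_injective K D) (incl_injective K D)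

/-- The affine toric variety `X = X_σ = Spec K[S_σ]`, as the set of its `K`-points, i.e. of the
algebra homomorphisms `K[S_σ] → K`; `x.eval f` is the value `f(x)` of a regular function `f`. -/
@[ext] structure Variety (K : Type*) [Field K] {N : Type*} [AddCommGroup N]
    (D : CorankOneDatum N) where
  eval : Coord K D →ₐ[K] K

variable {K D}

/-- The value `χ^u(x)`, `u ∈ S_σ`. -/
noncomputable def Variety.char (x : Variety K D) (u : D.S) : K := x.eval (chi K D u)

theorem Variety.ext_char {x y : Variety K D} (h : ∀ u, x.char u = y.char u) : x = y := by
  apply Variety.ext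
  exact AddMonoidAlgebra.algHom_ext (fun u => h u) (Subsingleton.elim _ _)

/-- The Zariski topology on `X`, induced from the prime spectrum of `K[X]` by sending a point to its
maximal ideal. -/
noncomputable instance : TopologicalSpace (Variety K D) :=
  TopologicalSpace.induced
    (fun x => (⟨RingHom.ker x.eval, RingHom.ker_isPrime x.eval⟩ : PrimeSpectrum (Coord K D)))
    inferInstance

open Classical in
/-- The distinguished point `x_τ`: `χ^u(x_τ) = 1` if `u ∈ τ^⊥` and `χ^u(x_τ) = 0` otherwise. -/
noncomputable def distPoint (K : Type*) [Field K] (D : CorankOneDatum N)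
    (τ : PointedCone ℚ (NQ N)) (hτ : τ ≤ D.σ) : Variety K D where
  eval := AddMonoidAlgebra.lift K K D.S
    { toFun := fun u => if InPerp (u.toAdd : Module.Dual ℤ N) τ then 1 else 0
      map_one' := by simp [InPerp]
      map_mul' := fun u w => by
        have : InPerp ((u * w).toAdd : Module.Dual ℤ N) τ ↔
            InPerp (u.toAdd : Module.Dual ℤ N) τ ∧ InPerp (w.toAdd : Module.Dual ℤ N) τ := by
          constructor
          · intro h
            constructor <;> intro v hv <;>
            · have h1 := h v hv
              have h2 := u.toAdd.2 v (hτ hv)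
              have h3 := w.toAdd.2 v (hτ hv)
              rw [toAdd_mul, AddSubmonoid.coe_add, pairQ_add, LinearMap.add_apply] at h1
              linarith
          · rintro ⟨h1, h2⟩ v hv
            rw [toAdd_mul, AddSubmonoid.coe_add, pairQ_add, LinearMap.add_apply, h1 v hv, h2 v hv,
              add_zero]
        by_cases h1 : InPerp (u.toAdd : Module.Dual ℤ N) τ <;>
        by_cases h2 : InPerp (w.toAdd : Module.Dual ℤ N) τ <;>
        simp only [this, h1, h2, if_true, if_false, and_true, and_false, mul_one, mul_zero] }

open Classical in
theorem distPoint_char (τ : PointedCone ℚ (NQ N)) (hτ : τ ≤ D.σ) (u : D.S) :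
    (distPoint K D τ hτ).char u = if InPerp (u : Module.Dual ℤ N) τ then 1 else 0 := by
  rw [Variety.char, distPoint, chi, AddMonoidAlgebra.lift_single, one_smul]
  rfl

theorem ρ_le : D.ρ ≤ D.σ := D.primitive_p.2.1.le

theorem inPerp_ρ (u : D.S) : InPerp (u : Module.Dual ℤ N) D.ρ ↔ D.deg u = 0 := by
  have hc := deg_cast u.2
  constructor
  · intro h
    have := h ((1 : ℚ) ⊗ₜ[ℤ] D.p) (Submodule.subset_span rfl)
    rw [pairQ_tmul, one_mul, ← hc] at this
    exact_mod_cast this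
  · intro h v hv
    rw [h] at hc
    unfold ρ ray at hv
    rw [← Finset.coe_singleton] at hv
    obtain ⟨a, ha, rfl⟩ := mem_hull_finset.1 hv
    simp [← hc]

/-- The orbit `O_τ` of the distinguished point `x_τ` under the torus `𝕋 = Hom(M, Kˣ)`, which acts by
`χ^u(t x) = t(u) χ^u(x)`. -/
def torusOrbit (K : Type*) [Field K] (D : CorankOneDatum N)
    (τ : PointedCone ℚ (NQ N)) (hτ : τ ≤ D.σ) : Set (Variety K D) :=
  {x | ∃ t : Multiplicative (Module.Dual ℤ N) →* Kˣ,
    ∀ u : D.S, x.char u = t (Multiplicative.ofAdd (u : Module.Dual ℤ N)) *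
      (distPoint K D τ hτ).char u}

/-- The closed subvariety `C` of `X` is isomorphic to the affine line: there is a bijection
`φ : K → C` that is a morphism (every regular function on `X` pulls back to a polynomial) and whose
inverse is a morphism (it is the restriction to `C` of a regular function on `X`). -/
def IsAffineLine (C : Set (Variety K D)) : Prop :=
  IsClosed C ∧ ∃ φ : K ≃ C,
    (∀ f : Coord K D, ∃ P : Polynomial K, ∀ t : K, (φ t).1.eval f = P.eval t) ∧
    ∃ f : Coord K D, ∀ t : K, (φ t).1.eval f = t

open Classical in
/-- `χ^u(x)`, extended by zero to `u ∈ M`. -/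
noncomputable def Variety.ex (x : Variety K D) (u : Module.Dual ℤ N) : K :=
  if h : u ∈ D.S then x.char ⟨u, h⟩ else 0

theorem Variety.ex_coe (x : Variety K D) (u : D.S) : x.ex u = x.char u := dif_pos u.2

theorem Variety.ext_ex {x y : Variety K D} (h : ∀ u ∈ D.S, x.ex u = y.ex u) : x = y :=
  Variety.ext_char fun u => by rw [← x.ex_coe, ← y.ex_coe]; exact h u u.2

/-- The unity of the multiplication on `X` is the distinguished point `x_ρ`. -/
noncomputable instance : One (Variety K D) where
  one := distPoint K D D.ρ ρ_le

theorem Variety.char_one (u : D.S) : (1 : Variety K D).char u = if D.deg u = 0 then 1 else 0 := by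
  classical
  refine (distPoint_char D.ρ ρ_le u).trans ?_
  simp only [inPerp_ρ]

theorem Variety.ex_one {u : Module.Dual ℤ N} (hu : u ∈ D.S) :
    (1 : Variety K D).ex u = if D.deg u = 0 then 1 else 0 :=
  (Variety.ex_coe _ ⟨u, hu⟩).trans (Variety.char_one _)

variable (K D) [Module.Free ℤ N] [Module.Finite ℤ N]

/-- The element `χ^u ⊗ χ^u (1 ⊗ χ^{e₁} + χ^{e₂} ⊗ 1)^{⟨p, u⟩}` of `K[X] ⊗ K[X]`, written as
`∑_{i + j = ⟨p, u⟩} (⟨p, u⟩ choose i) χ^{u + i e₂} ⊗ χ^{u + j e₁}`. -/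
noncomputable def comulChi (u : D.S) : Coord K D ⊗[K] Coord K D :=
  ∑ ij ∈ (Finset.HasAntidiagonal.antidiagonal (D.deg u)).attach,
    ((D.deg u).choose ij.1.1) •
      (chi K D ⟨u + ij.1.1 • D.e₂,
          shift_mem D.root₂ u.2 (fst_le_of_mem ij.2)⟩ ⊗ₜ[K]
        chi K D ⟨u + ij.1.2 • D.e₁,
          shift_mem D.root₁ u.2 (snd_le_of_mem ij.2)⟩)

/-- The equality of the two forms of `comulChi`, in `K[M] ⊗ K[M]`. -/
theorem map_comulChi (u : D.S) :
    Algebra.TensorProduct.map (incl K D) (incl K D) (comulChi K D u) =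
      (chiM K (u : Module.Dual ℤ N) ⊗ₜ[K] chiM K (u : Module.Dual ℤ N)) *
        ((1 : TorusCoord K N) ⊗ₜ[K] chiM K D.e₁ +
          chiM K D.e₂ ⊗ₜ[K] (1 : TorusCoord K N)) ^ D.deg u := by
  rw [add_comm (_ ⊗ₜ _), (Commute.all _ _).add_pow', Finset.mul_sum, comulChi, map_sum]
  rw [← Finset.sum_attach (Finset.HasAntidiagonal.antidiagonal (D.deg u))]
  refine Finset.sum_congr rfl fun ij _ => ?_
  rw [map_nsmul, Algebra.TensorProduct.map_tmul, incl_chi, incl_chi, chiM_add, chiM_add,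
    chiM_nsmul, chiM_nsmul, mul_smul_comm]
  simp [Algebra.TensorProduct.tmul_pow, Algebra.TensorProduct.tmul_mul_tmul]

/-- The comultiplication `K[X] → K[X] ⊗ K[X]`, the algebra homomorphism with
`χ^u ↦ χ^u ⊗ χ^u (1 ⊗ χ^{e₁} + χ^{e₂} ⊗ 1)^{⟨p, u⟩}`. -/
noncomputable def comul : Coord K D →ₐ[K] Coord K D ⊗[K] Coord K D :=
  AddMonoidAlgebra.lift K (Coord K D ⊗[K] Coord K D) D.S
    { toFun := fun u => comulChi K D u.toAdd
      map_one' := by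
        apply map_incl_injective K D
        rw [map_comulChi]
        simp [deg, chiM_zero, Algebra.TensorProduct.one_def]
      map_mul' := fun u w => by
        apply map_incl_injective K D
        rw [map_mul (Algebra.TensorProduct.map _ _), map_comulChi, map_comulChi, map_comulChi, toAdd_mul]
        simp only [AddSubmonoid.coe_add, deg_add u.toAdd.2 w.toAdd.2, pow_add,
          chiM_add]
        rw [← Algebra.TensorProduct.tmul_mul_tmul]
        ring }

theorem comul_chi (u : D.S) : comul K D (chi K D u) = comulChi K D u := by
  rw [comul, chi, AddMonoidAlgebra.lift_single, one_smul]
  rfl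

/-- The comultiplication is given by `χ^u ↦ χ^u ⊗ χ^u (1 ⊗ χ^{e₁} + χ^{e₂} ⊗ 1)^{⟨p, u⟩}`, after the
embedding of `K[X] ⊗ K[X]` into `K[M] ⊗ K[M]`. -/
theorem map_comul_chi (u : D.S) :
    Algebra.TensorProduct.map (incl K D) (incl K D) (comul K D (chi K D u)) =
      (chiM K (u : Module.Dual ℤ N) ⊗ₜ[K] chiM K (u : Module.Dual ℤ N)) *
        ((1 : TorusCoord K N) ⊗ₜ[K] chiM K D.e₁ +
          chiM K D.e₂ ⊗ₜ[K] (1 : TorusCoord K N)) ^ D.deg u := by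
  rw [comul_chi, map_comulChi]

variable {K D}

/-- The multiplication `X × X → X` dual to the comultiplication. -/
noncomputable instance : Mul (Variety K D) where
  mul x y := ⟨(Algebra.TensorProduct.productMap x.eval y.eval).comp (comul K D)⟩

theorem Variety.ex_mul (x y : Variety K D) {u : Module.Dual ℤ N} (hu : u ∈ D.S) :
    (x * y).ex u = ∑ ij ∈ Finset.HasAntidiagonal.antidiagonal (D.deg u),
      ((D.deg u).choose ij.1 : K) * (x.ex (u + ij.1 • D.e₂) * y.ex (u + ij.2 • D.e₁)) := by
  have : (x * y).ex u = Algebra.TensorProduct.productMap x.eval y.eval (comulChi K D ⟨u, hu⟩) := by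
    rw [← comul_chi]; exact dif_pos hu
  rw [this, comulChi, map_sum, ← Finset.sum_attach (Finset.HasAntidiagonal.antidiagonal (D.deg u))]
  refine Finset.sum_congr rfl fun ij _ => ?_
  rw [map_nsmul, Algebra.TensorProduct.productMap_apply_tmul, nsmul_eq_mul]
  congr 2
  · exact (Variety.ex_coe x ⟨_, shift_mem D.root₂ hu (fst_le_of_mem ij.2)⟩).symm
  · exact (Variety.ex_coe y ⟨_, shift_mem D.root₁ hu (snd_le_of_mem ij.2)⟩).symm

/-- The product of two points in terms of the values of the characters. -/
theorem Variety.char_mul (x y : Variety K D) (u : D.S) :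
    (x * y).char u = ∑ ij ∈ (Finset.HasAntidiagonal.antidiagonal (D.deg u)).attach,
      ((D.deg u).choose ij.1.1 : K) *
        (x.char ⟨u + ij.1.1 • D.e₂, shift_mem D.root₂ u.2 (fst_le_of_mem ij.2)⟩ *
         y.char ⟨u + ij.1.2 • D.e₁, shift_mem D.root₁ u.2 (snd_le_of_mem ij.2)⟩) := by
  rw [← Variety.ex_coe, Variety.ex_mul x y u.2, ← Finset.sum_attach]
  refine Finset.sum_congr rfl fun ij _ => ?_
  simp only [← Variety.ex_coe]

/-- The monoid structure on `X`. -/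
noncomputable instance : Monoid (Variety K D) where
  mul_assoc x y z := by
    apply Variety.ext_ex
    intro u hu
    rw [Variety.ex_mul _ _ hu, Variety.ex_mul _ _ hu]
    have h1 : ∀ ij ∈ Finset.HasAntidiagonal.antidiagonal (D.deg u),
        ((D.deg u).choose ij.1 : K) * ((x * y).ex (u + ij.1 • D.e₂) * z.ex (u + ij.2 • D.e₁)) =
        ∑ kl ∈ Finset.HasAntidiagonal.antidiagonal ij.2, ((D.deg u).choose ij.1 * (ij.2).choose kl.1 : K) *
          (x.ex (u + (ij.1 + kl.1) • D.e₂) * y.ex (u + ij.1 • D.e₂ + kl.2 • D.e₁) *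
            z.ex (u + (kl.1 + kl.2) • D.e₁)) := by
      rintro ⟨i, j⟩ hij
      have hij' := Finset.HasAntidiagonal.mem_antidiagonal.1 hij
      dsimp only at hij' ⊢
      rw [Variety.ex_mul _ _ (shift_mem D.root₂ hu (by omega)), deg_shift D.root₂ hu,
        show D.deg u - i = j by omega, Finset.sum_mul, Finset.mul_sum]
      refine Finset.sum_congr rfl ?_
      rintro ⟨k, l⟩ hkl
      have hkl' := Finset.HasAntidiagonal.mem_antidiagonal.1 hkl
      dsimp only at hkl' ⊢
      rw [hkl', add_smul, ← add_assoc]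
      ring
    have h2 : ∀ ab ∈ Finset.HasAntidiagonal.antidiagonal (D.deg u),
        ((D.deg u).choose ab.1 : K) * (x.ex (u + ab.1 • D.e₂) * (y * z).ex (u + ab.2 • D.e₁)) =
        ∑ cd ∈ Finset.HasAntidiagonal.antidiagonal ab.1, ((D.deg u).choose ab.1 * (ab.1).choose cd.1 : K) *
          (x.ex (u + (cd.1 + cd.2) • D.e₂) * y.ex (u + cd.1 • D.e₂ + ab.2 • D.e₁) *
            z.ex (u + (cd.2 + ab.2) • D.e₁)) := by
      rintro ⟨a, b⟩ hab
      have hab' := Finset.HasAntidiagonal.mem_antidiagonal.1 hab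
      dsimp only at hab' ⊢
      rw [Variety.ex_mul _ _ (shift_mem D.root₁ hu (by omega)), deg_shift D.root₁ hu,
        show D.deg u - b = a by omega, Finset.mul_sum, Finset.mul_sum]
      refine Finset.sum_congr rfl ?_
      rintro ⟨c, d⟩ hcd
      have hcd' := Finset.HasAntidiagonal.mem_antidiagonal.1 hcd
      dsimp only at hcd' ⊢
      rw [hcd', add_comm d b, add_smul b d, ← add_assoc, add_right_comm u (b • D.e₁)]
      ring
    rw [Finset.sum_congr rfl h1, Finset.sum_congr rfl h2, Finset.sum_sigma', Finset.sum_sigma']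
    refine Finset.sum_bij' (fun s _ => ⟨(s.1.1 + s.2.1, s.2.2), (s.1.1, s.2.1)⟩)
      (fun s _ => ⟨(s.2.1, s.2.2 + s.1.2), (s.2.2, s.1.2)⟩) ?_ ?_ ?_ ?_ ?_
    · rintro ⟨⟨i, j⟩, ⟨k, l⟩⟩ h
      simp only [Finset.mem_sigma, Finset.HasAntidiagonal.mem_antidiagonal] at h ⊢
      obtain ⟨h1, h2⟩ := h
      subst h2
      exact ⟨by omega, trivial⟩
    · rintro ⟨⟨i, j⟩, ⟨k, l⟩⟩ h
      simp only [Finset.mem_sigma, Finset.HasAntidiagonal.mem_antidiagonal] at h ⊢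
      obtain ⟨h1, h2⟩ := h
      subst h2
      exact ⟨by omega, trivial⟩
    · rintro ⟨⟨i, j⟩, ⟨k, l⟩⟩ h
      simp only [Finset.mem_sigma, Finset.HasAntidiagonal.mem_antidiagonal] at h
      obtain ⟨-, rfl⟩ := h
      rfl
    · rintro ⟨⟨i, j⟩, ⟨k, l⟩⟩ h
      simp only [Finset.mem_sigma, Finset.HasAntidiagonal.mem_antidiagonal] at h
      obtain ⟨-, rfl⟩ := h
      rfl
    · rintro ⟨⟨i, j⟩, ⟨k, l⟩⟩ h
      simp only [Finset.mem_sigma, Finset.HasAntidiagonal.mem_antidiagonal] at h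
      dsimp only
      have hch : (D.deg u).choose (i + k) * (i + k).choose i = (D.deg u).choose i * j.choose k := by
        rw [Nat.choose_mul (Nat.le_add_right i k), show D.deg u - i = j by omega,
          Nat.add_sub_cancel_left]
      have hch' : ((D.deg u).choose (i + k) * (i + k).choose i : K) =
          (D.deg u).choose i * j.choose k := by exact_mod_cast congrArg (Nat.cast (R := K)) hch
      rw [hch']
  one_mul x := by
    apply Variety.ext_ex
    intro u hu
    rw [Variety.ex_mul _ _ hu, Finset.sum_eq_single (D.deg u, 0)]
    · have := shift_mem D.root₂ hu le_rfl
      rw [Variety.ex_one this, deg_shift D.root₂ hu]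
      simp
    · rintro ⟨i, j⟩ hij hne
      have hij' := Finset.HasAntidiagonal.mem_antidiagonal.1 hij
      dsimp only at hij' ⊢
      have hj : j ≠ 0 := by rintro rfl; exact hne (by rw [← hij', add_zero])
      rw [Variety.ex_one (shift_mem D.root₂ hu (by omega)), deg_shift D.root₂ hu, if_neg (by omega)]
      simp
    · intro h; simp at h
  mul_one x := by
    apply Variety.ext_ex
    intro u hu
    rw [Variety.ex_mul _ _ hu, Finset.sum_eq_single (0, D.deg u)]
    · have := shift_mem D.root₁ hu le_rfl
      rw [Variety.ex_one this, deg_shift D.root₁ hu]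
      simp
    · rintro ⟨i, j⟩ hij hne
      have hij' := Finset.HasAntidiagonal.mem_antidiagonal.1 hij
      dsimp only at hij' ⊢
      have hi : i ≠ 0 := by rintro rfl; exact hne (by rw [← hij', zero_add])
      rw [Variety.ex_one (shift_mem D.root₁ hu (by omega)), deg_shift D.root₁ hu, if_neg (by omega)]
      simp
    · intro h; simp at h

/-- The set `E(X)` of the idempotents, i.e. of the points `x` with `x * x = x`. -/
def idempotents (K : Type*) [Field K] (D : CorankOneDatum N) : Set (Variety K D) :=
  {x | IsIdempotentElem x}

/-- The set `E_γ` of the idempotents in the torus orbit `O_γ`. -/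
def idempotentsIn (K : Type*) [Field K] (D : CorankOneDatum N)
    (γ : PointedCone ℚ (NQ N)) (hγ : γ ≤ D.σ) : Set (Variety K D) :=
  idempotents K D ∩ torusOrbit K D γ hγ

/-- The irreducible components of `E(X)` (in the Zariski topology), as subsets of `X`. -/
def idempotentComponents (K : Type*) [Field K] (D : CorankOneDatum N) : Set (Set (Variety K D)) :=
  (fun C : Set (idempotents K D) => Subtype.val '' C) '' irreducibleComponents (idempotents K D)

/-- The orbit of `x` under the action `(g, h) · x = g * x * h⁻¹` of `G × G` on `X`, where `G` is the
group of invertible elements of the monoid `X`. -/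
def unitOrbit (x : Variety K D) : Set (Variety K D) :=
  {y | ∃ g h : (Variety K D)ˣ, y = (g : Variety K D) * x * ((h⁻¹ : (Variety K D)ˣ) : Variety K D)}

end CorankOneDatum
end ToricMonoid

open ToricMonoid ToricMonoid.CorankOneDatum

/-!
The points of `X` are the multiplicative functions `x : S_σ → K`, and `Variety.ex_mul` is their
product. Two constructions carry the argument. The *core* of a point keeps its values on the
characters `χ^u` with `⟨p, u⟩ = 0` and is zero on all others. The points `u_s` with
`χ^u(u_s) = s^{⟨p, u⟩}` form a subgroup `𝔾_a` of `G`, and for an idempotent core `y` the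
products `y * u_s` and `u_s * y` are the curves `χ^u ↦ χ^{u + n e}(y) s^n`, `n = ⟨p, u⟩`, for
`e = e₂` and `e = e₁` respectively (`core_mul_translation`, `translation_mul_core`). Such a curve
is the constant `y` unless the root `e` is *active* at `y`, and then `s` is a regular function on it.

`idempotent_cases` is the main point: an idempotent `x` different from its core lies on one of these
curves through its core, and exactly one of the two roots is active. Indeed, if `χ^{u₀}(x) ≠ 0` for
some `u₀` with `⟨p, u₀⟩ > 0`, some summand of `χ^{u₀}(x * x)` is nonzero, which makes a root active
and moves `x` to its curve (`eq_rootLine`); if both roots were active, the equation `x * x = x` would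
read `s^n = (s + s)^n`, i.e. `2^n = 1`. Therefore the idempotents with a given core form a point or
an affine line, contained in one `G × G`-orbit.

Characters with `⟨p, u⟩ = 0` are multiplicative for `*`, so they take the values `0` and `1` on
idempotents. They are constant on irreducible sets of idempotents, so that the components of `E(X)`
are the fibres of the core map (`exists_eq_fibre`); and their vanishing is invariant under `G × G`,
so that an orbit meets at most one fibre (`fibre_eq_of_mem_unitOrbit`).

For a face `γ` without `ρ` the point `x_{cone(γ, ρ)}` is a core, at which a root is active if and
only if it belongs to `γ^⊥` (`active_distPoint_sup_iff`). If this holds for exactly one of the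
roots, `E_γ` is the corresponding line without the point `s = 0`, which is `x_{cone(γ, ρ)}`
(`idempotentsIn_eq`).
-/

namespace ToricMonoid.CorankOneDatum

variable {K : Type*} [Field K] {N : Type*} [AddCommGroup N] {D : CorankOneDatum N}

/-! ### Points as multiplicative functions on `S_σ` -/

namespace Variety

theorem ex_zero (x : Variety K D) : x.ex 0 = 1 :=
  (x.ex_coe 0).trans (map_one x.eval)

theorem ex_add (x : Variety K D) {u w : Module.Dual ℤ N} (hu : u ∈ D.S) (hw : w ∈ D.S) :
    x.ex (u + w) = x.ex u * x.ex w := by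
  have h : chi K D (⟨u, hu⟩ + ⟨w, hw⟩) = chi K D ⟨u, hu⟩ * chi K D ⟨w, hw⟩ := by
    simp [chi, AddMonoidAlgebra.single_mul_single]
  have := congrArg x.eval h
  rw [map_mul] at this
  change x.char (⟨u, hu⟩ + ⟨w, hw⟩) = x.char ⟨u, hu⟩ * x.char ⟨w, hw⟩ at this
  rwa [← ex_coe, ← ex_coe, ← ex_coe] at this

theorem ex_nsmul (x : Variety K D) {u : Module.Dual ℤ N} (hu : u ∈ D.S) (k : ℕ) :
    x.ex (k • u) = x.ex u ^ k := by
  induction k with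
  | zero => simp [ex_zero]
  | succ k ih => rw [succ_nsmul, ex_add x (D.S.nsmul_mem hu k) hu, ih, pow_succ]

/-- The point of `X` at which the characters take the values of a multiplicative function. -/
noncomputable def ofFun (f : Module.Dual ℤ N → K) (h0 : f 0 = 1)
    (hadd : ∀ u ∈ D.S, ∀ w ∈ D.S, f (u + w) = f u * f w) : Variety K D where
  eval := AddMonoidAlgebra.lift K K D.S
    { toFun := fun u => f u.toAdd
      map_one' := h0
      map_mul' := fun u w => hadd _ u.toAdd.2 _ w.toAdd.2 }

theorem ex_ofFun {f : Module.Dual ℤ N → K} {h0 : f 0 = 1}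
    {hadd : ∀ u ∈ D.S, ∀ w ∈ D.S, f (u + w) = f u * f w} {u : Module.Dual ℤ N} (hu : u ∈ D.S) :
    (ofFun f h0 hadd : Variety K D).ex u = f u := by
  rw [← Subtype.coe_mk u hu, ex_coe, char, ofFun, chi, AddMonoidAlgebra.lift_single, one_smul]
  rfl

end Variety

theorem deg_zero : D.deg 0 = 0 := rfl

theorem shift_add_shift {u w e : Module.Dual ℤ N} (hu : u ∈ D.S) (hw : w ∈ D.S) :
    (u + w) + D.deg (u + w) • e = (u + D.deg u • e) + (w + D.deg w • e) := by
  rw [deg_add hu hw, add_smul]; abel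

/-- The core of a point `x`: it has the values of `x` on the characters `χ^u` with `⟨p, u⟩ = 0`, and
all other characters vanish at it. -/
noncomputable def core (x : Variety K D) : Variety K D :=
  Variety.ofFun (fun u => if D.deg u = 0 then x.ex u else 0) (by simp [deg_zero, x.ex_zero])
    (fun u hu w hw => by
      simp only [deg_add hu hw, x.ex_add hu hw, Nat.add_eq_zero_iff]
      split_ifs <;> simp_all)

theorem ex_core (x : Variety K D) {u : Module.Dual ℤ N} (hu : u ∈ D.S) :
    (core x).ex u = if D.deg u = 0 then x.ex u else 0 :=
  Variety.ex_ofFun hu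

theorem core_core (x : Variety K D) : core (core x) = core x :=
  Variety.ext_ex fun u hu => by
    rw [ex_core _ hu, ex_core _ hu]; split_ifs <;> rfl

theorem core_eq_core_iff {x y : Variety K D} :
    core x = core y ↔ ∀ u ∈ D.S, D.deg u = 0 → x.ex u = y.ex u := by
  constructor
  · intro h u hu hd
    have := congrArg (fun z => z.ex u) h
    simpa [ex_core _ hu, hd] using this
  · intro h
    refine Variety.ext_ex fun u hu => ?_
    rw [ex_core _ hu, ex_core _ hu]
    split_ifs with hd
    exacts [h u hu hd, rfl]

/-- The point `u_s` of the one-parameter subgroup `𝔾_a ⊆ G`: `χ^u(u_s) = s^{⟨p, u⟩}`. -/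
noncomputable def translation (D : CorankOneDatum N) (s : K) : Variety K D :=
  Variety.ofFun (fun u => s ^ D.deg u) (by simp [deg_zero])
    (fun u hu w hw => by simp only [deg_add hu hw, pow_add])

theorem ex_translation (s : K) {u : Module.Dual ℤ N} (hu : u ∈ D.S) :
    (translation D s).ex u = s ^ D.deg u :=
  Variety.ex_ofFun hu

theorem deg_shift_self {e : Module.Dual ℤ N} (he : IsDemazureRoot D.σ D.p e)
    {u : Module.Dual ℤ N} (hu : u ∈ D.S) : D.deg (u + D.deg u • e) = 0 := by
  rw [deg_shift he hu, Nat.sub_self]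

theorem translation_zero : translation D (0 : K) = 1 :=
  Variety.ext_ex fun u hu => by
    rw [ex_translation _ hu, Variety.ex_one hu, zero_pow_eq]

section

variable [Module.Free ℤ N] [Module.Finite ℤ N]

/-- A Demazure root `e` and a point `y` define an algebra homomorphism `K[X] → K[t]`,
`χ^u ↦ χ^{u + n e}(y) t^n` with `n = ⟨p, u⟩`. -/
noncomputable def rootPoly {e : Module.Dual ℤ N} (he : IsDemazureRoot D.σ D.p e)
    (y : Variety K D) : Coord K D →ₐ[K] Polynomial K :=
  AddMonoidAlgebra.lift K (Polynomial K) D.S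
    { toFun := fun u => Polynomial.monomial (D.deg u.toAdd)
        (y.ex ((u.toAdd : Module.Dual ℤ N) + D.deg u.toAdd • e))
      map_one' := by
        change Polynomial.monomial 0 (y.ex (0 + 0 • e)) = 1
        rw [zero_smul, add_zero, y.ex_zero]; rfl
      map_mul' := fun u w => by
        simp only [toAdd_mul, AddSubmonoid.coe_add]
        rw [shift_add_shift u.toAdd.2 w.toAdd.2,
          y.ex_add (shift_mem he u.toAdd.2 le_rfl) (shift_mem he w.toAdd.2 le_rfl),
          deg_add u.toAdd.2 w.toAdd.2, Polynomial.monomial_mul_monomial] }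

/-- The curve `s ↦ rootLine he y s` in `X` given by `rootPoly he y`. -/
noncomputable def rootLine {e : Module.Dual ℤ N} (he : IsDemazureRoot D.σ D.p e)
    (y : Variety K D) (s : K) : Variety K D where
  eval := (Polynomial.aeval s).comp (rootPoly he y)

theorem eval_rootLine {e : Module.Dual ℤ N} (he : IsDemazureRoot D.σ D.p e)
    (y : Variety K D) (s : K) (f : Coord K D) :
    (rootLine he y s).eval f = (rootPoly he y f).eval s := by
  rw [rootLine, AlgHom.comp_apply, Polynomial.coe_aeval_eq_eval]

theorem ex_rootLine {e : Module.Dual ℤ N} (he : IsDemazureRoot D.σ D.p e)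
    (y : Variety K D) (s : K) {u : Module.Dual ℤ N} (hu : u ∈ D.S) :
    (rootLine he y s).ex u = y.ex (u + D.deg u • e) * s ^ D.deg u := by
  rw [← Subtype.coe_mk u hu, Variety.ex_coe, Variety.char, eval_rootLine, rootPoly, chi,
    AddMonoidAlgebra.lift_single, one_smul]
  exact Polynomial.eval_monomial

/-! ### Products with the one-parameter subgroup -/

theorem ex_mul_of_deg_eq_zero (x y : Variety K D) {u : Module.Dual ℤ N} (hu : u ∈ D.S)
    (h : D.deg u = 0) : (x * y).ex u = x.ex u * y.ex u := by
  rw [Variety.ex_mul x y hu, h]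
  simp

theorem translation_mul_translation (s t : K) :
    translation D s * translation D t = translation D (s + t) := by
  refine Variety.ext_ex fun u hu => ?_
  rw [Variety.ex_mul _ _ hu, ex_translation _ hu, (Commute.all s t).add_pow',
    ← Finset.Nat.sum_antidiagonal_swap]
  refine Finset.sum_congr rfl fun ij hij => ?_
  have h := Finset.HasAntidiagonal.mem_antidiagonal.1 hij
  have hi : ij.1 ≤ D.deg u := by omega
  have hj : ij.2 ≤ D.deg u := by omega
  rw [Prod.fst_swap, Prod.snd_swap, ex_translation _ (shift_mem D.root₂ hu hj),
    ex_translation _ (shift_mem D.root₁ hu hi), deg_shift D.root₂ hu, deg_shift D.root₁ hu,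
    nsmul_eq_mul, show D.deg u - ij.2 = ij.1 by omega, show D.deg u - ij.1 = ij.2 by omega,
    Nat.choose_symm_of_eq_add h.symm]

/-- `translation D s` as an invertible element of `X`. -/
noncomputable def translationUnit (D : CorankOneDatum N) (s : K) : (Variety K D)ˣ where
  val := translation D s
  inv := translation D (-s)
  val_inv := by rw [translation_mul_translation, add_neg_cancel, translation_zero]
  inv_val := by rw [translation_mul_translation, neg_add_cancel, translation_zero]

theorem core_mul_translation (x : Variety K D) (s : K) :
    core x * translation D s = rootLine D.root₂ (core x) s := by
  refine Variety.ext_ex fun u hu => ?_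
  rw [Variety.ex_mul _ _ hu, ex_rootLine _ _ _ hu, Finset.sum_eq_single (D.deg u, 0)]
  · simp [ex_translation _ hu]
  · rintro ⟨i, j⟩ hij hne
    have h := Finset.HasAntidiagonal.mem_antidiagonal.1 hij
    dsimp only at h ⊢
    have hj : j ≠ 0 := by rintro rfl; exact hne (by rw [← h, add_zero])
    rw [ex_core _ (shift_mem D.root₂ hu (by omega)), deg_shift D.root₂ hu, if_neg (by omega)]
    simp
  · intro h; simp at h

theorem translation_mul_core (x : Variety K D) (s : K) :
    translation D s * core x = rootLine D.root₁ (core x) s := by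
  refine Variety.ext_ex fun u hu => ?_
  rw [Variety.ex_mul _ _ hu, ex_rootLine _ _ _ hu, Finset.sum_eq_single (0, D.deg u)]
  · simp [ex_translation _ hu, mul_comm]
  · rintro ⟨i, j⟩ hij hne
    have h := Finset.HasAntidiagonal.mem_antidiagonal.1 hij
    dsimp only at h ⊢
    have hi : i ≠ 0 := by rintro rfl; exact hne (by rw [← h, zero_add])
    rw [ex_core _ (shift_mem D.root₁ hu (by omega)), deg_shift D.root₁ hu, if_neg (by omega)]
    simp
  · intro h; simp at h

/-- For `⟨p, u⟩ = 0` the character `χ^u` is multiplicative for `*`, hence has no zeros on `G`. -/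
theorem ex_unit_ne_zero (g : (Variety K D)ˣ) {u : Module.Dual ℤ N} (hu : u ∈ D.S)
    (h : D.deg u = 0) : (g : Variety K D).ex u ≠ 0 := by
  intro h0
  have := ex_mul_of_deg_eq_zero (g : Variety K D) ((g⁻¹ : (Variety K D)ˣ) : Variety K D) hu h
  rw [Units.mul_inv, Variety.ex_one hu, if_pos h, h0, zero_mul] at this
  exact one_ne_zero this

theorem ex_eq_zero_iff_of_mem_unitOrbit {x y : Variety K D} (hy : y ∈ unitOrbit x)
    {u : Module.Dual ℤ N} (hu : u ∈ D.S) (h : D.deg u = 0) : y.ex u = 0 ↔ x.ex u = 0 := by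
  obtain ⟨g, k, rfl⟩ := hy
  rw [ex_mul_of_deg_eq_zero _ _ hu h, ex_mul_of_deg_eq_zero _ _ hu h]
  simp [ex_unit_ne_zero _ hu h]

/-! ### Idempotents -/

theorem ex_eq_zero_or_one {x : Variety K D} (hx : x ∈ idempotents K D) {u : Module.Dual ℤ N}
    (hu : u ∈ D.S) (h : D.deg u = 0) : x.ex u = 0 ∨ x.ex u = 1 := by
  have h1 := ex_mul_of_deg_eq_zero x x hu h
  rw [show x * x = x from hx] at h1
  rcases mul_eq_zero.1 (show x.ex u * (x.ex u - 1) = 0 by linear_combination -h1) with h2 | h2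
  exacts [Or.inl h2, Or.inr (sub_eq_zero.1 h2)]

theorem core_mem_idempotents_of_forall {x : Variety K D}
    (hx : ∀ u ∈ D.S, D.deg u = 0 → x.ex u = 0 ∨ x.ex u = 1) : core x ∈ idempotents K D := by
  refine Variety.ext_ex fun u hu => ?_
  by_cases h : D.deg u = 0
  · rw [ex_mul_of_deg_eq_zero _ _ hu h, ex_core _ hu, if_pos h]
    rcases hx u hu h with h | h <;> simp [h]
  · rw [Variety.ex_mul _ _ hu, ex_core _ hu, if_neg h]
    refine Finset.sum_eq_zero fun ij hij => ?_
    have h' := Finset.HasAntidiagonal.mem_antidiagonal.1 hij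
    rw [ex_core _ (shift_mem D.root₂ hu (by omega)), ex_core _ (shift_mem D.root₁ hu (by omega)),
      deg_shift D.root₂ hu, deg_shift D.root₁ hu]
    split_ifs
    · omega
    all_goals simp

theorem core_mem_idempotents {x : Variety K D} (hx : x ∈ idempotents K D) :
    core x ∈ idempotents K D :=
  core_mem_idempotents_of_forall fun _ hu h => ex_eq_zero_or_one hx hu h

/-- The root `e` is active at `y` if the curve `s ↦ rootLine he y s` is not constant. For `y = x_τ`
with `ρ` a ray of `τ` this means that `e` vanishes on all other rays of `τ`. -/
def Active (e : Module.Dual ℤ N) (y : Variety K D) : Prop :=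
  ∃ u ∈ D.S, D.deg u ≠ 0 ∧ y.ex (u + D.deg u • e) ≠ 0

theorem active_core_iff {e : Module.Dual ℤ N} (he : IsDemazureRoot D.σ D.p e) {x : Variety K D} :
    Active e (core x) ↔ Active e x := by
  refine exists_congr fun u => and_congr_right fun hu => ?_
  rw [ex_core _ (shift_mem he hu le_rfl), if_pos (deg_shift_self he hu)]

theorem rootLine_core_of_not_active {e : Module.Dual ℤ N} (he : IsDemazureRoot D.σ D.p e)
    {x : Variety K D} (h : ¬ Active e x) (s : K) : rootLine he (core x) s = core x := by
  rw [← active_core_iff he] at h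
  refine Variety.ext_ex fun u hu => ?_
  rw [ex_rootLine _ _ _ hu]
  by_cases hd : D.deg u = 0
  · simp [hd]
  · rw [ex_core _ hu, if_neg hd, not_not.1 fun h' => h ⟨u, hu, hd, h'⟩, zero_mul]

theorem rootLine_zero {e : Module.Dual ℤ N} (he : IsDemazureRoot D.σ D.p e)
    (x : Variety K D) : rootLine he (core x) 0 = core x := by
  refine Variety.ext_ex fun u hu => ?_
  rw [ex_rootLine _ _ _ hu]
  by_cases hd : D.deg u = 0
  · simp [hd]
  · rw [ex_core _ hu, if_neg hd, zero_pow hd, mul_zero]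

theorem core_rootLine {e : Module.Dual ℤ N} (he : IsDemazureRoot D.σ D.p e)
    (x : Variety K D) (s : K) : core (rootLine he x s) = core x :=
  core_eq_core_iff.2 fun u hu hd => by rw [ex_rootLine _ _ _ hu]; simp [hd]

/-- If `e₁` is not active at `x`, then `u_s * y = y` for the core `y` of `x`, so that `y * u_s` is
idempotent. -/
theorem rootLine_mem_idempotents₂ {x : Variety K D} (hx : x ∈ idempotents K D)
    (h : ¬ Active D.e₁ x) (s : K) : rootLine D.root₂ (core x) s ∈ idempotents K D := by
  have h1 : translation D s * core x = core x := by
    rw [translation_mul_core, rootLine_core_of_not_active _ h]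
  have h2 : core x * core x = core x := core_mem_idempotents hx
  rw [← core_mul_translation]
  change core x * translation D s * (core x * translation D s) = core x * translation D s
  rw [mul_assoc, ← mul_assoc (translation D s), h1, ← mul_assoc, h2]

theorem rootLine_mem_idempotents₁ {x : Variety K D} (hx : x ∈ idempotents K D)
    (h : ¬ Active D.e₂ x) (s : K) : rootLine D.root₁ (core x) s ∈ idempotents K D := by
  have h1 : core x * translation D s = core x := by
    rw [core_mul_translation, rootLine_core_of_not_active _ h]
  have h2 : core x * core x = core x := core_mem_idempotents hx
  rw [← translation_mul_core]
  change translation D s * core x * (translation D s * core x) = translation D s * core x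
  rw [mul_assoc, ← mul_assoc (core x), h1, h2]

/-- The identity `n₀ (u + i e) + i u₀ = n₀ u + i (u₀ + n₀ e)`, `n₀ = ⟨p, u₀⟩`, evaluated at `x`. It
compares the vanishing of shifted characters for different characters. -/
theorem ex_shift_pow_mul {e : Module.Dual ℤ N} (he : IsDemazureRoot D.σ D.p e) (x : Variety K D)
    {u u₀ : Module.Dual ℤ N} (hu : u ∈ D.S) (hu₀ : u₀ ∈ D.S) {i : ℕ} (hi : i ≤ D.deg u) :
    x.ex (u + i • e) ^ D.deg u₀ * x.ex u₀ ^ i =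
      x.ex u ^ D.deg u₀ * x.ex (u₀ + D.deg u₀ • e) ^ i := by
  have h1 := shift_mem he hu hi
  have h2 := shift_mem he hu₀ le_rfl
  rw [← x.ex_nsmul h1, ← x.ex_nsmul hu₀, ← x.ex_nsmul hu, ← x.ex_nsmul h2,
    ← x.ex_add (D.S.nsmul_mem h1 _) (D.S.nsmul_mem hu₀ _),
    ← x.ex_add (D.S.nsmul_mem hu _) (D.S.nsmul_mem h2 _)]
  congr 1
  rw [smul_add, smul_add, smul_smul, smul_smul, mul_comm i]
  abel

theorem ex_shift_ne_zero {e : Module.Dual ℤ N} (he : IsDemazureRoot D.σ D.p e) {x : Variety K D}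
    {u u₀ : Module.Dual ℤ N} (hu : u ∈ D.S) (hu₀ : u₀ ∈ D.S) {i : ℕ} (hi : i ≤ D.deg u)
    (hi0 : i ≠ 0) (h : x.ex (u + i • e) ≠ 0) (h₀ : x.ex u₀ ≠ 0) :
    x.ex (u₀ + D.deg u₀ • e) ≠ 0 := by
  intro hc
  have := ex_shift_pow_mul he x hu hu₀ hi
  rw [hc, zero_pow hi0, mul_zero] at this
  exact mul_ne_zero (pow_ne_zero _ h) (pow_ne_zero _ h₀) this

/-- A point at which some `χ^{u₀}` and its shift by `⟨p, u₀⟩ e` do not vanish lies on the curve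
through its core that is defined by `e`. -/
theorem eq_rootLine {e : Module.Dual ℤ N} (he : IsDemazureRoot D.σ D.p e) {x : Variety K D}
    {u₀ : Module.Dual ℤ N} (hu₀ : u₀ ∈ D.S) (hd : D.deg u₀ ≠ 0) (h₀ : x.ex u₀ ≠ 0)
    (h : x.ex (u₀ + D.deg u₀ • e) ≠ 0) :
    ∃ s, s ≠ 0 ∧ x = rootLine he (core x) s := by
  have h1m := shift_mem he hu₀ (Nat.one_le_iff_ne_zero.2 hd)
  have h1 : x.ex (u₀ + 1 • e) ≠ 0 := by
    intro hc
    have := ex_shift_pow_mul he x hu₀ hu₀ (Nat.one_le_iff_ne_zero.2 hd)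
    rw [hc, zero_pow hd, zero_mul, pow_one] at this
    exact mul_ne_zero (pow_ne_zero _ h₀) h this.symm
  refine ⟨x.ex u₀ / x.ex (u₀ + 1 • e), div_ne_zero h₀ h1, Variety.ext_ex fun u hu => ?_⟩
  have h2m := shift_mem he hu le_rfl
  rw [ex_rootLine _ _ _ hu, ex_core _ h2m, if_pos (deg_shift_self he hu), div_pow, ← mul_div_assoc,
    eq_div_iff (pow_ne_zero _ h1), ← x.ex_nsmul h1m, ← x.ex_nsmul hu₀,
    ← x.ex_add hu (D.S.nsmul_mem h1m _), ← x.ex_add h2m (D.S.nsmul_mem hu₀ _)]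
  congr 1
  rw [smul_add, one_smul]
  abel

/-- An idempotent different from its core is on one of the two curves through its core, and only
one of the two roots is active at it. -/
theorem idempotent_cases [CharZero K] {x : Variety K D} (hx : x ∈ idempotents K D) :
    x = core x ∨
      (Active D.e₂ x ∧ ¬ Active D.e₁ x ∧ ∃ s, s ≠ 0 ∧ x = rootLine D.root₂ (core x) s) ∨
      (Active D.e₁ x ∧ ¬ Active D.e₂ x ∧ ∃ s, s ≠ 0 ∧ x = rootLine D.root₁ (core x) s) := by
  by_cases hcore : ∀ u ∈ D.S, D.deg u ≠ 0 → x.ex u = 0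
  · left
    refine Variety.ext_ex fun u hu => ?_
    rw [ex_core _ hu]
    split_ifs with hd
    exacts [rfl, hcore u hu hd]
  right
  push Not at hcore
  obtain ⟨u₀, hu₀, hd, h₀⟩ := hcore
  have hact : ∀ {e : Module.Dual ℤ N}, IsDemazureRoot D.σ D.p e → Active e x →
      x.ex (u₀ + D.deg u₀ • e) ≠ 0 := by
    rintro e he ⟨u, hu, hdu, h⟩
    exact ex_shift_ne_zero he hu hu₀ le_rfl hdu h h₀
  have hprod := Variety.ex_mul x x hu₀
  rw [show x * x = x from hx] at hprod
  have hor : Active D.e₁ x ∨ Active D.e₂ x := by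
    by_contra hcon
    push Not at hcon
    refine h₀ (hprod.trans (Finset.sum_eq_zero ?_))
    rintro ⟨i, j⟩ hij
    have h := Finset.HasAntidiagonal.mem_antidiagonal.1 hij
    dsimp only at h ⊢
    by_contra hne
    have hne2 := right_ne_zero_of_mul hne
    by_cases hi : i = 0
    · exact hcon.1 ⟨u₀, hu₀, hd, ex_shift_ne_zero D.root₁ hu₀ hu₀ (by omega) (by omega)
        (right_ne_zero_of_mul hne2) h₀⟩
    · exact hcon.2 ⟨u₀, hu₀, hd, ex_shift_ne_zero D.root₂ hu₀ hu₀ (by omega) hi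
        (left_ne_zero_of_mul hne2) h₀⟩
  have hnand : ¬ (Active D.e₁ x ∧ Active D.e₂ x) := by
    rintro ⟨ha₁, ha₂⟩
    obtain ⟨s, hs, hxs⟩ := eq_rootLine D.root₁ hu₀ hd h₀ (hact D.root₁ ha₁)
    obtain ⟨t, ht, hxt⟩ := eq_rootLine D.root₂ hu₀ hd h₀ (hact D.root₂ ha₂)
    -- If both roots are active, `χ^u(x)` is `0` or `s^{⟨p, u⟩}`, where `s` is the same for both
    -- roots, and `x * x = x` becomes `2^{⟨p, u₀⟩} = 1`.
    have hval : ∀ {e : Module.Dual ℤ N} (he : IsDemazureRoot D.σ D.p e) (r : K),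
        x = rootLine he (core x) r → ∀ u ∈ D.S, x.ex u ≠ 0 → x.ex u = r ^ D.deg u := by
      intro e he r hr u hu hne
      have h1 : x.ex u = (rootLine he (core x) r).ex u := by rw [← hr]
      rw [ex_rootLine _ _ _ hu] at h1
      rcases ex_eq_zero_or_one (core_mem_idempotents hx) (shift_mem he hu le_rfl)
        (deg_shift_self he hu) with h2 | h2
      · rw [h2, zero_mul] at h1; exact absurd h1 hne
      · rw [h2, one_mul] at h1; exact h1
    have hne : ∀ {e : Module.Dual ℤ N} (he : IsDemazureRoot D.σ D.p e), Active e x →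
        ∀ i ≤ D.deg u₀, x.ex (u₀ + i • e) ≠ 0 := by
      intro e he ha i hi hc
      have := ex_shift_pow_mul he x hu₀ hu₀ hi
      rw [hc, zero_pow hd, zero_mul] at this
      exact mul_ne_zero (pow_ne_zero _ h₀) (pow_ne_zero _ (hact he ha)) this.symm
    have hpow : ∀ {e : Module.Dual ℤ N} (he : IsDemazureRoot D.σ D.p e), Active e x →
        ∀ i ≤ D.deg u₀, x.ex (u₀ + i • e) = s ^ (D.deg u₀ - i) := by
      intro e he ha i hi
      rw [hval D.root₁ s hxs _ (shift_mem he hu₀ hi) (hne he ha i hi), deg_shift he hu₀]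
    have h1 : s ^ D.deg u₀ = ∑ ij ∈ Finset.HasAntidiagonal.antidiagonal (D.deg u₀),
        (D.deg u₀).choose ij.1 • (s ^ ij.1 * s ^ ij.2) := by
      rw [← hval D.root₁ s hxs u₀ hu₀ h₀, hprod]
      refine Finset.sum_congr rfl ?_
      rintro ⟨i, j⟩ hij
      have h := Finset.HasAntidiagonal.mem_antidiagonal.1 hij
      dsimp only at h ⊢
      rw [hpow D.root₂ ha₂ i (by omega), hpow D.root₁ ha₁ j (by omega), nsmul_eq_mul,
        show D.deg u₀ - i = j by omega, show D.deg u₀ - j = i by omega, mul_comm (s ^ j)]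
    rw [← (Commute.all s s).add_pow', ← two_mul, mul_pow] at h1
    have h2 : (2 : K) ^ D.deg u₀ = 1 :=
      mul_right_cancel₀ (pow_ne_zero (D.deg u₀) hs) (by rw [← h1, one_mul])
    have h3 : 2 ^ D.deg u₀ = 1 := by exact_mod_cast h2
    exact hd (by simpa using h3)
  rcases hor with ha | ha
  · exact Or.inr ⟨ha, fun h => hnand ⟨ha, h⟩,
      eq_rootLine D.root₁ hu₀ hd h₀ (hact D.root₁ ha)⟩
  · exact Or.inl ⟨ha, fun h => hnand ⟨h, ha⟩,
      eq_rootLine D.root₂ hu₀ hd h₀ (hact D.root₂ ha)⟩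

end

/-! ### The Zariski topology -/

theorem isClosed_eval_eq_zero (f : Coord K D) : IsClosed {x : Variety K D | x.eval f = 0} := by
  refine isClosed_induced_iff.2 ⟨PrimeSpectrum.zeroLocus {f}, PrimeSpectrum.isClosed_zeroLocus _, ?_⟩
  ext x
  simp [PrimeSpectrum.mem_zeroLocus, RingHom.mem_ker]

/-- The sets `{x | f(x) ≠ 0}` form a basis of the Zariski topology on `X`. -/
theorem exists_eval_ne_zero {U : Set (Variety K D)} (hU : IsOpen U) {x : Variety K D}
    (hx : x ∈ U) : ∃ f : Coord K D, x.eval f ≠ 0 ∧ ∀ z : Variety K D, z.eval f ≠ 0 → z ∈ U := by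
  obtain ⟨V, hV, rfl⟩ := isOpen_induced_iff.1 hU
  obtain ⟨_, ⟨f, rfl⟩, h1, h2⟩ :=
    PrimeSpectrum.isTopologicalBasis_basic_opens.exists_subset_of_mem_open hx hV
  refine ⟨f, fun h => h1 (RingHom.mem_ker.2 h), fun z hz => h2 fun h => hz (RingHom.mem_ker.1 h)⟩

theorem isClosed_ex_eq (u : Module.Dual ℤ N) (c : K) :
    IsClosed {x : Variety K D | x.ex u = c} := by
  by_cases hu : u ∈ D.S
  · convert isClosed_eval_eq_zero (chi K D ⟨u, hu⟩ - algebraMap K _ c) using 3 with x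
    rw [map_sub, AlgHom.commutes, sub_eq_zero, show x.ex u = _ from x.ex_coe ⟨u, hu⟩]
    rfl
  · simp only [Variety.ex, hu, dite_false]
    exact isClosed_const

theorem exists_eval_polynomial_ne_zero {R : Type*} [CommRing R] [IsDomain R] [Infinite R] {P : Polynomial R} (hP : P ≠ 0) :
    ∃ s, P.eval s ≠ 0 := by
  by_contra! h
  exact hP (Polynomial.funext fun s => by simp [h])

section

variable [Module.Free ℤ N] [Module.Finite ℤ N]

/-- The set `E(X)` is closed: it is the common zero set of the functions `f(x * x) - f(x)`. -/
theorem isClosed_idempotents : IsClosed (idempotents K D) := by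
  have h : idempotents K D = ⋂ f : Coord K D,
      {x | x.eval (Algebra.TensorProduct.lmul' K (comul K D f) - f) = 0} := by
    ext x
    have hx : ∀ z, x.eval (Algebra.TensorProduct.lmul' K z) =
        Algebra.TensorProduct.productMap x.eval x.eval z := by
      intro z
      rw [← AlgHom.comp_apply]
      congr 1
      ext <;> simp
    simp only [Set.mem_iInter, Set.mem_ofPred_eq, map_sub, hx, sub_eq_zero]
    constructor
    · intro h f
      exact DFunLike.congr_fun (congrArg Variety.eval h) f
    · intro h
      exact Variety.ext (AlgHom.ext h)
  rw [h]
  exact isClosed_iInter fun f => isClosed_eval_eq_zero _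

/-! ### Components of the set of idempotents -/

/-- The idempotents with the same core as `x`. -/
def fibre (x : Variety K D) : Set (Variety K D) := {z | z ∈ idempotents K D ∧ core z = core x}

theorem fibre_eq_of_mem {x z : Variety K D} (h : z ∈ fibre x) : fibre z = fibre x := by
  ext w
  simp only [fibre, Set.mem_ofPred_eq, h.2]

theorem isClosed_fibre (x : Variety K D) : IsClosed (fibre x) := by
  have : fibre x = idempotents K D ∩
      ⋂ u ∈ D.S, ⋂ _ : D.deg u = 0, {z : Variety K D | z.ex u = x.ex u} := by
    ext z
    simp [fibre, core_eq_core_iff]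
  rw [this]
  exact isClosed_idempotents.inter <| isClosed_biInter fun u _ => isClosed_iInter fun _ =>
    isClosed_ex_eq u _

/-- The parameter of the curve of an active root is the restriction of a regular function on `X`. -/
theorem exists_coordinate_rootLine {e : Module.Dual ℤ N} (he : IsDemazureRoot D.σ D.p e)
    {x : Variety K D} (hx : x ∈ idempotents K D) (h : Active e x) :
    ∃ f : Coord K D, ∀ s, (rootLine he (core x) s).eval f = s := by
  obtain ⟨u, hu, hd, hne⟩ := h
  -- The character of `u + (n - 1) e` is a coordinate on the curve, as `⟨p, u + (n - 1) e⟩ = 1`.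
  have hm := shift_mem he hu (Nat.sub_le (D.deg u) 1)
  have hdeg : D.deg (u + (D.deg u - 1) • e) = 1 := by rw [deg_shift he hu]; omega
  refine ⟨chi K D ⟨_, hm⟩, fun s => ?_⟩
  change (rootLine he (core x) s).char _ = s
  rw [← Variety.ex_coe, ex_rootLine _ _ _ hm, hdeg, pow_one, add_assoc, ← add_smul,
    Nat.sub_add_cancel (Nat.one_le_iff_ne_zero.2 hd), ex_core _ (shift_mem he hu le_rfl),
    if_pos (deg_shift_self he hu)]
  rw [(ex_eq_zero_or_one hx (shift_mem he hu le_rfl) (deg_shift_self he hu)).resolve_left hne,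
    one_mul]

theorem isAffineLine_range_rootLine {e : Module.Dual ℤ N} (he : IsDemazureRoot D.σ D.p e)
    {x : Variety K D} (hx : x ∈ idempotents K D) (h : Active e x)
    (hcl : IsClosed (Set.range (rootLine he (core x)))) :
    IsAffineLine (Set.range (rootLine he (core x))) := by
  obtain ⟨f, hf⟩ := exists_coordinate_rootLine he hx h
  have hinj : Function.Injective (rootLine he (core x)) := fun s t hst => by
    rw [← hf s, hst, hf]
  exact ⟨hcl, Equiv.ofInjective _ hinj, fun g => ⟨rootPoly he (core x) g, fun t =>
    eval_rootLine he _ t g⟩, f, hf⟩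

theorem isIrreducible_range_rootLine [Infinite K] {e : Module.Dual ℤ N}
    (he : IsDemazureRoot D.σ D.p e) (x : Variety K D) :
    IsIrreducible (Set.range (rootLine he x)) := by
  refine ⟨⟨_, 0, rfl⟩, ?_⟩
  rintro U V hU hV ⟨_, ⟨s, rfl⟩, hs⟩ ⟨_, ⟨t, rfl⟩, ht⟩
  obtain ⟨f, hf, hfU⟩ := exists_eval_ne_zero hU hs
  obtain ⟨g, hg, hgV⟩ := exists_eval_ne_zero hV ht
  rw [eval_rootLine] at hf hg
  have hP : rootPoly he x f * rootPoly he x g ≠ 0 :=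
    mul_ne_zero (by rintro h; simp [h] at hf) (by rintro h; simp [h] at hg)
  obtain ⟨r, hr⟩ := exists_eval_polynomial_ne_zero hP
  rw [Polynomial.eval_mul] at hr
  refine ⟨_, ⟨r, rfl⟩, hfU _ ?_, hgV _ ?_⟩ <;> rw [eval_rootLine]
  exacts [left_ne_zero_of_mul hr, right_ne_zero_of_mul hr]

theorem self_mem_fibre {x : Variety K D} (hx : x ∈ idempotents K D) : x ∈ fibre x := ⟨hx, rfl⟩

theorem active_iff_of_mem_fibre {e : Module.Dual ℤ N} (he : IsDemazureRoot D.σ D.p e)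
    {x z : Variety K D} (h : z ∈ fibre x) : Active e z ↔ Active e x := by
  rw [← active_core_iff he, h.2, active_core_iff he]

theorem fibre_eq_range₂ [CharZero K] {x : Variety K D} (hx : x ∈ idempotents K D)
    (h₁ : ¬ Active D.e₁ x) : fibre x = Set.range (rootLine D.root₂ (core x)) := by
  refine Set.Subset.antisymm (fun z hz => ?_) ?_
  · rcases idempotent_cases hz.1 with h | ⟨-, -, s, -, h⟩ | ⟨h, -⟩
    · exact ⟨0, by rw [rootLine_zero, ← hz.2, ← h]⟩
    · exact ⟨s, by rw [← hz.2, ← h]⟩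
    · exact absurd ((active_iff_of_mem_fibre D.root₁ hz).1 h) h₁
  · rintro _ ⟨s, rfl⟩
    exact ⟨rootLine_mem_idempotents₂ hx h₁ s, by rw [core_rootLine, core_core]⟩

theorem fibre_eq_range₁ [CharZero K] {x : Variety K D} (hx : x ∈ idempotents K D)
    (h₂ : ¬ Active D.e₂ x) : fibre x = Set.range (rootLine D.root₁ (core x)) := by
  refine Set.Subset.antisymm (fun z hz => ?_) ?_
  · rcases idempotent_cases hz.1 with h | ⟨h, -⟩ | ⟨-, -, s, -, h⟩
    · exact ⟨0, by rw [rootLine_zero, ← hz.2, ← h]⟩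
    · exact absurd ((active_iff_of_mem_fibre D.root₂ hz).1 h) h₂
    · exact ⟨s, by rw [← hz.2, ← h]⟩
  · rintro _ ⟨s, rfl⟩
    exact ⟨rootLine_mem_idempotents₁ hx h₂ s, by rw [core_rootLine, core_core]⟩

/-- If both roots or none of them are active at `x`, its core is the only idempotent of the fibre. -/
theorem fibre_eq_singleton [CharZero K] {x : Variety K D} (hx : x ∈ idempotents K D)
    (h : Active D.e₁ x ↔ Active D.e₂ x) : fibre x = {core x} := by
  refine Set.Subset.antisymm (fun z hz => ?_) ?_
  · rw [← active_iff_of_mem_fibre D.root₁ hz, ← active_iff_of_mem_fibre D.root₂ hz] at h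
    rcases idempotent_cases hz.1 with h' | ⟨h₂, h₁, -⟩ | ⟨h₁, h₂, -⟩
    · exact h'.trans hz.2
    · exact absurd (h.2 h₂) h₁
    · exact absurd (h.1 h₁) h₂
  · rintro _ rfl
    exact ⟨core_mem_idempotents hx, core_core x⟩

theorem fibre_subset_unitOrbit [CharZero K] {x : Variety K D} (hx : x ∈ idempotents K D) :
    fibre x ⊆ unitOrbit (core x) := by
  by_cases h₁ : Active D.e₁ x
  · by_cases h₂ : Active D.e₂ x
    · rw [fibre_eq_singleton hx (by simp [h₁, h₂])]
      rintro _ rfl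
      exact ⟨1, 1, by simp⟩
    · rw [fibre_eq_range₁ hx h₂]
      rintro _ ⟨s, rfl⟩
      refine ⟨translationUnit D s, 1, ?_⟩
      rw [inv_one, Units.val_one, mul_one]
      exact (translation_mul_core x s).symm
  · rw [fibre_eq_range₂ hx h₁]
    rintro _ ⟨s, rfl⟩
    refine ⟨1, (translationUnit D s)⁻¹, ?_⟩
    rw [inv_inv, Units.val_one, one_mul]
    exact (core_mul_translation x s).symm

theorem isIrreducible_fibre [CharZero K] {x : Variety K D} (hx : x ∈ idempotents K D) :
    IsIrreducible (fibre x) := by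
  by_cases h₁ : Active D.e₁ x
  · by_cases h₂ : Active D.e₂ x
    · rw [fibre_eq_singleton hx (by simp [h₁, h₂])]
      exact isIrreducible_singleton
    · rw [fibre_eq_range₁ hx h₂]
      exact isIrreducible_range_rootLine _ _
  · rw [fibre_eq_range₂ hx h₁]
    exact isIrreducible_range_rootLine _ _

theorem fibre_eq_singleton_or_isAffineLine [CharZero K] {x : Variety K D}
    (hx : x ∈ idempotents K D) : (∃ y, fibre x = {y}) ∨ IsAffineLine (fibre x) := by
  have hcl := isClosed_fibre x
  by_cases h₁ : Active D.e₁ x <;> by_cases h₂ : Active D.e₂ x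
  · exact Or.inl ⟨_, fibre_eq_singleton hx (by simp [h₁, h₂])⟩
  · rw [fibre_eq_range₁ hx h₂] at hcl ⊢
    exact Or.inr (isAffineLine_range_rootLine _ hx h₁ hcl)
  · rw [fibre_eq_range₂ hx h₁] at hcl ⊢
    exact Or.inr (isAffineLine_range_rootLine _ hx h₂ hcl)
  · exact Or.inl ⟨_, fibre_eq_singleton hx (by simp [h₁, h₂])⟩

/-- An irreducible set of idempotents is contained in one fibre: a character `χ^u` with
`⟨p, u⟩ = 0` takes only the values `0` and `1` on idempotents, hence is constant on the set. -/
theorem subset_fibre_of_isPreirreducible {C : Set (Variety K D)} (hC : IsPreirreducible C)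
    (hCE : C ⊆ idempotents K D) {x : Variety K D} (hx : x ∈ C) : C ⊆ fibre x := by
  refine fun z hz => ⟨hCE hz, core_eq_core_iff.2 fun u hu hd => ?_⟩
  rcases isPreirreducible_iff_isClosed_union_isClosed.1 hC _ _ (isClosed_ex_eq u 0)
    (isClosed_ex_eq u 1) (fun w hw => ex_eq_zero_or_one (hCE hw) hu hd) with h | h
  all_goals exact (h hz).trans (h hx).symm

/-- The irreducible components of `E(X)` are fibres of the core map. -/
theorem exists_eq_fibre [CharZero K] {C : Set (Variety K D)} (hC : C ∈ idempotentComponents K D) :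
    ∃ x ∈ idempotents K D, C = fibre x := by
  obtain ⟨Z, hZ, rfl⟩ := hC
  obtain ⟨x, hx⟩ := hZ.1.1
  refine ⟨x, x.2, Set.Subset.antisymm ?_ ?_⟩
  · exact subset_fibre_of_isPreirreducible
      (hZ.1.2.image _ continuous_subtype_val.continuousOn)
      (by rintro _ ⟨z, -, rfl⟩; exact z.2) ⟨x, hx, rfl⟩
  · have hirr : IsIrreducible (Subtype.val ⁻¹' fibre (x : Variety K D) :
        Set (idempotents K D)) := by
      refine ⟨⟨x, self_mem_fibre x.2⟩, ?_⟩
      rintro _ _ ⟨U, hU, rfl⟩ ⟨V, hV, rfl⟩ ⟨a, ha, haU⟩ ⟨b, hb, hbV⟩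
      obtain ⟨c, hc, hcUV⟩ := (isIrreducible_fibre x.2).2 U V hU hV ⟨a, ha, haU⟩ ⟨b, hb, hbV⟩
      exact ⟨⟨c, hc.1⟩, hc, hcUV⟩
    have hle : Z ⊆ Subtype.val ⁻¹' fibre (x : Variety K D) := fun z hz =>
      subset_fibre_of_isPreirreducible (hZ.1.2.image _ continuous_subtype_val.continuousOn)
        (by rintro _ ⟨z, -, rfl⟩; exact z.2) ⟨x, hx, rfl⟩ ⟨z, hz, rfl⟩
    exact fun z hz => ⟨⟨z, hz.1⟩, hZ.2 hirr hle hz, rfl⟩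

/-- Points of one `G × G`-orbit have the same vanishing characters `χ^u` with `⟨p, u⟩ = 0`, so that
idempotents of one orbit have the same core. -/
theorem fibre_eq_of_mem_unitOrbit {x a b : Variety K D} (ha : a ∈ idempotents K D)
    (hb : b ∈ idempotents K D) (hax : a ∈ unitOrbit x) (hbx : b ∈ unitOrbit x) :
    fibre a = fibre b := by
  refine fibre_eq_of_mem ⟨ha, core_eq_core_iff.2 fun u hu hd => ?_⟩
  have h : a.ex u = 0 ↔ b.ex u = 0 :=
    (ex_eq_zero_iff_of_mem_unitOrbit hax hu hd).trans
      (ex_eq_zero_iff_of_mem_unitOrbit hbx hu hd).symm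
  rcases ex_eq_zero_or_one ha hu hd with h1 | h1 <;>
    rcases ex_eq_zero_or_one hb hu hd with h2 | h2 <;> simp_all

end

/-! ### Faces and the closures of the sets `E_γ` -/

theorem pairQ_shift (u e : Module.Dual ℤ N) (n : ℕ) (v : NQ N) :
    pairQ (u + n • e) v = pairQ u v + n * pairQ e v := by
  have : pairQ (n • e) = n • pairQ e := by ext; simp
  rw [pairQ_add, this, LinearMap.add_apply, LinearMap.smul_apply, nsmul_eq_mul]

/-- `γ ⊔ ρ` is the cone generated by `γ` and `ρ`, and `cone(γ, ρ)^⊥ ∩ S_σ` consists of the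
`u ∈ γ^⊥ ∩ S_σ` with `⟨p, u⟩ = 0`. -/
theorem ex_distPoint_sup {γ : PointedCone ℚ (NQ N)} (hγ : γ ≤ D.σ) {u : Module.Dual ℤ N}
    (hu : u ∈ D.S) [Decidable (InPerp u γ ∧ D.deg u = 0)] :
    (distPoint K D (γ ⊔ D.ρ) (sup_le hγ ρ_le)).ex u =
      if InPerp u γ ∧ D.deg u = 0 then 1 else 0 := by
  have h : InPerp u (γ ⊔ D.ρ) ↔ InPerp u γ ∧ D.deg u = 0 := by
    rw [← inPerp_ρ ⟨u, hu⟩]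
    constructor
    · exact fun h => ⟨fun v hv => h v (le_sup_left (a := γ) hv), fun v hv =>
        h v (le_sup_right (b := D.ρ) hv)⟩
    · rintro ⟨h1, h2⟩ v hv
      obtain ⟨a, ha, b, hb, rfl⟩ := Submodule.mem_sup.1 hv
      rw [map_add, h1 a ha, h2 b hb, add_zero]
  refine (Variety.ex_coe _ ⟨u, hu⟩).trans ?_
  rw [distPoint_char]
  simp only [h]

theorem core_distPoint_sup {γ : PointedCone ℚ (NQ N)} (hγ : γ ≤ D.σ) :
    core (distPoint K D (γ ⊔ D.ρ) (sup_le hγ ρ_le)) =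
      distPoint K D (γ ⊔ D.ρ) (sup_le hγ ρ_le) := by
  classical
  refine Variety.ext_ex fun u hu => ?_
  rw [ex_core _ hu, ex_distPoint_sup hγ hu]
  split_ifs <;> simp_all

theorem ex_ne_zero_iff_of_mem_torusOrbit {γ : PointedCone ℚ (NQ N)} {hγ : γ ≤ D.σ}
    {x : Variety K D} (hx : x ∈ torusOrbit K D γ hγ) {u : Module.Dual ℤ N} (hu : u ∈ D.S) :
    x.ex u ≠ 0 ↔ InPerp u γ := by
  obtain ⟨t, ht⟩ := hx
  rw [← Subtype.coe_mk u hu, Variety.ex_coe, ht, distPoint_char]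
  simp

variable [Module.Free ℤ N] [Module.Finite ℤ N]

/-- A functional on `N_ℚ` is, up to a positive factor, given by an element of `M`. -/
theorem exists_pairQ_eq_smul (f : Module.Dual ℚ (NQ N)) :
    ∃ (m : ℚ) (u : Module.Dual ℤ N), 0 < m ∧ pairQ u = m • f := by
  let b := Module.Free.chooseBasis ℤ N
  obtain ⟨d, hd⟩ := IsLocalization.exist_integer_multiples_of_finite (nonZeroDivisors ℤ)
    (fun i => f ((1 : ℚ) ⊗ₜ[ℤ] b i))
  choose c hc using hd
  have hd0 : ((d : ℤ) : ℚ) ≠ 0 := by exact_mod_cast nonZeroDivisors.coe_ne_zero d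
  -- The denominator `d` need not be positive, its square is.
  refine ⟨(d : ℤ) * (d : ℤ), b.constr ℤ fun i => (d : ℤ) * c i, mul_self_pos.2 hd0, ?_⟩
  ext v
  have : (Algebra.linearMap ℤ ℚ).comp (b.constr ℤ fun i => (d : ℤ) * c i) =
      (AddMonoidHom.mk' (fun v : N => ((d : ℤ) : ℚ) * (d : ℤ) * f ((1 : ℚ) ⊗ₜ[ℤ] v)) fun v w => by
        rw [TensorProduct.tmul_add, map_add, mul_add]).toIntLinearMap := by
    refine b.ext fun i => ?_
    have h := hc i
    simp only [LinearMap.comp_apply, Module.Basis.constr_basis, Algebra.linearMap_apply]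
    simp only [algebraMap_int_eq, eq_intCast, zsmul_eq_mul] at h
    simp [h, mul_assoc]
  have h := LinearMap.congr_fun this v
  simpa using h

/-- A face of `σ` that does not contain `ρ` is cut out by some `u ∈ S_σ` with `⟨p, u⟩ > 0`. -/
theorem exists_inPerp_deg_ne_zero {γ : PointedCone ℚ (NQ N)} (hγ : IsFace γ D.σ)
    (hp : ¬ IsRay D.ρ γ) : ∃ u ∈ D.S, InPerp u γ ∧ D.deg u ≠ 0 := by
  have hpσ : (1 : ℚ) ⊗ₜ[ℤ] D.p ∈ D.σ := ρ_le (Submodule.subset_span rfl)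
  have hpγ : (1 : ℚ) ⊗ₜ[ℤ] D.p ∉ γ := by
    intro h
    obtain ⟨⟨g, hg, hgρ⟩, hfin⟩ := D.primitive_p.2
    have hle : D.ρ ≤ γ := Submodule.span_le.2 (by rintro _ rfl; exact h)
    exact hp ⟨⟨g, fun v hv => hg v (hγ.le hv), fun v =>
      ⟨fun hv => ⟨hle hv, ((hgρ v).1 hv).2⟩, fun hv => (hgρ v).2 ⟨hγ.le hv.1, hv.2⟩⟩⟩, hfin⟩
  obtain ⟨f, hf, hfγ⟩ := hγ
  obtain ⟨m, u, hm, hu⟩ := exists_pairQ_eq_smul f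
  refine ⟨u, fun v hv => ?_, fun v hv => ?_, fun hd => hpγ ((hfγ _).2 ⟨hpσ, ?_⟩)⟩
  · rw [hu, LinearMap.smul_apply, smul_eq_mul]
    exact mul_nonneg hm.le (hf v hv)
  · rw [hu, LinearMap.smul_apply, ((hfγ v).1 hv).2, smul_zero]
  · have huS : u ∈ D.S := fun v hv => by
      rw [hu, LinearMap.smul_apply, smul_eq_mul]
      exact mul_nonneg hm.le (hf v hv)
    have h1 := deg_cast huS
    have h2 := pairQ_tmul u 1 D.p
    rw [← h1, hd, hu, LinearMap.smul_apply, smul_eq_mul] at h2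
    simpa [hm.ne'] using h2

theorem distPoint_sup_mem_idempotents {γ : PointedCone ℚ (NQ N)} (hγ : γ ≤ D.σ) :
    distPoint K D (γ ⊔ D.ρ) (sup_le hγ ρ_le) ∈ idempotents K D := by
  classical
  rw [← core_distPoint_sup hγ]
  refine core_mem_idempotents_of_forall fun u hu _ => ?_
  rw [ex_distPoint_sup hγ hu]
  split_ifs <;> simp

/-- For a face `γ` that does not contain `ρ`, a root is active at `x_{cone(γ, ρ)}` if and only if it
belongs to `γ^⊥`. -/
theorem active_distPoint_sup_iff {e : Module.Dual ℤ N} (he : IsDemazureRoot D.σ D.p e)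
    {γ : PointedCone ℚ (NQ N)} (hγ : IsFace γ D.σ) (hp : ¬ IsRay D.ρ γ) :
    Active e (distPoint K D (γ ⊔ D.ρ) (sup_le hγ.le ρ_le)) ↔ InPerp e γ := by
  classical
  obtain ⟨u₀, hu₀, hu₀γ, hd₀⟩ := exists_inPerp_deg_ne_zero hγ hp
  constructor
  · rintro ⟨u, hu, hd, h⟩ v hv
    rw [ex_distPoint_sup hγ.le (shift_mem he hu le_rfl)] at h
    have h1 : InPerp (u + D.deg u • e) γ := by
      by_contra hcon
      exact h (if_neg fun h' => hcon h'.1)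
    have h2 := h1 v hv
    have h3 := shift_mem he hu₀ le_rfl v (hγ.le hv)
    rw [pairQ_shift] at h2 h3
    rw [hu₀γ v hv, zero_add] at h3
    have h4 := hu v (hγ.le hv)
    have hd' : (0 : ℚ) < D.deg u := by exact_mod_cast Nat.pos_of_ne_zero hd
    have hd₀' : (0 : ℚ) < D.deg u₀ := by exact_mod_cast Nat.pos_of_ne_zero hd₀
    have h5 : 0 ≤ pairQ e v := nonneg_of_mul_nonneg_right h3 hd₀'
    have h6 : (D.deg u : ℚ) * pairQ e v = 0 := by
      have := mul_nonneg hd'.le h5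
      linarith
    exact (mul_eq_zero.1 h6).resolve_left hd'.ne'
  · intro h
    refine ⟨u₀, hu₀, hd₀, ?_⟩
    rw [ex_distPoint_sup hγ.le (shift_mem he hu₀ le_rfl), if_pos]
    · exact one_ne_zero
    · refine ⟨fun v hv => ?_, deg_shift_self he hu₀⟩
      rw [pairQ_shift, hu₀γ v hv, h v hv, mul_zero, add_zero]

theorem rootLine_mem_torusOrbit {e : Module.Dual ℤ N} (he : IsDemazureRoot D.σ D.p e)
    {γ : PointedCone ℚ (NQ N)} (hγ : γ ≤ D.σ) (heγ : InPerp e γ) {s : K} (hs : s ≠ 0) :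
    rootLine he (distPoint K D (γ ⊔ D.ρ) (sup_le hγ ρ_le)) s ∈ torusOrbit K D γ hγ := by
  classical
  refine ⟨{ toFun := fun u => Units.mk0 s hs ^ (u.toAdd D.p)
            map_one' := by simp
            map_mul' := fun u w => by simp [zpow_add] }, fun u => ?_⟩
  have h : InPerp ((u : Module.Dual ℤ N) + D.deg u • e) γ ↔ InPerp (u : Module.Dual ℤ N) γ := by
    refine forall₂_congr fun v hv => ?_
    rw [pairQ_shift, heγ v hv, mul_zero, add_zero]
  rw [← Variety.ex_coe, ex_rootLine _ _ _ u.2, ex_distPoint_sup hγ (shift_mem he u.2 le_rfl),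
    distPoint_char, mul_comm]
  simp only [h, deg_shift_self he u.2, and_true]
  congr 1
  simp [← deg_cast u.2]

/-- The set `E_γ` is the curve through `x_{cone(γ, ρ)}` without this point, as soon as the curve is the
whole fibre of the core map. -/
theorem idempotentsIn_eq {e : Module.Dual ℤ N} (he : IsDemazureRoot D.σ D.p e)
    {γ : PointedCone ℚ (NQ N)} (hγ : IsFace γ D.σ) (hp : ¬ IsRay D.ρ γ) (heγ : InPerp e γ)
    (hfib : fibre (distPoint K D (γ ⊔ D.ρ) (sup_le hγ.le ρ_le)) =
      Set.range (rootLine he (distPoint K D (γ ⊔ D.ρ) (sup_le hγ.le ρ_le)))) :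
    idempotentsIn K D γ hγ.le =
      rootLine he (distPoint K D (γ ⊔ D.ρ) (sup_le hγ.le ρ_le)) '' {0}ᶜ := by
  classical
  ext x
  constructor
  · rintro ⟨hxE, hxO⟩
    have hx : x ∈ fibre (distPoint K D (γ ⊔ D.ρ) (sup_le hγ.le ρ_le)) := by
      refine ⟨hxE, core_eq_core_iff.2 fun u hu hd => ?_⟩
      have h1 := ex_ne_zero_iff_of_mem_torusOrbit hxO hu
      rw [ex_distPoint_sup hγ.le hu]
      rcases ex_eq_zero_or_one hxE hu hd with h2 | h2
      · rw [if_neg fun h => h1.2 h.1 h2, h2]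
      · rw [if_pos ⟨h1.1 (by rw [h2]; exact one_ne_zero), hd⟩, h2]
    rw [hfib] at hx
    obtain ⟨s, rfl⟩ := hx
    refine ⟨s, fun hs => ?_, rfl⟩
    obtain rfl : s = 0 := hs
    obtain ⟨u₀, hu₀, hu₀γ, hd₀⟩ := exists_inPerp_deg_ne_zero hγ hp
    refine (ex_ne_zero_iff_of_mem_torusOrbit hxO hu₀).2 hu₀γ ?_
    rw [ex_rootLine _ _ _ hu₀, zero_pow hd₀, mul_zero]
  · rintro ⟨s, hs, rfl⟩
    have h : rootLine he (distPoint K D (γ ⊔ D.ρ) (sup_le hγ.le ρ_le)) s ∈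
        fibre (distPoint K D (γ ⊔ D.ρ) (sup_le hγ.le ρ_le)) := hfib ▸ ⟨s, rfl⟩
    exact ⟨h.1, rootLine_mem_torusOrbit he hγ.le heγ hs⟩

/-- A polynomial that vanishes at all `s ≠ 0` vanishes at `0`. -/
theorem rootLine_zero_mem_closure [Infinite K] {e : Module.Dual ℤ N}
    (he : IsDemazureRoot D.σ D.p e) (y : Variety K D) :
    rootLine he y 0 ∈ closure (rootLine he y '' {0}ᶜ) := by
  rw [mem_closure_iff]
  intro U hU h0
  obtain ⟨f, hf, hfU⟩ := exists_eval_ne_zero hU h0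
  rw [eval_rootLine] at hf
  have hP : rootPoly he y f * Polynomial.X ≠ 0 :=
    mul_ne_zero (by rintro h; simp [h] at hf) Polynomial.X_ne_zero
  obtain ⟨s, hs⟩ := exists_eval_polynomial_ne_zero hP
  rw [Polynomial.eval_mul, Polynomial.eval_X] at hs
  exact ⟨_, hfU _ (by rw [eval_rootLine]; exact left_ne_zero_of_mul hs),
    s, right_ne_zero_of_mul hs, rfl⟩

theorem closure_idempotentsIn [Infinite K] {e : Module.Dual ℤ N}
    (he : IsDemazureRoot D.σ D.p e)
    {γ : PointedCone ℚ (NQ N)} (hγ : IsFace γ D.σ) (hp : ¬ IsRay D.ρ γ) (heγ : InPerp e γ)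
    (hfib : fibre (distPoint K D (γ ⊔ D.ρ) (sup_le hγ.le ρ_le)) =
      Set.range (rootLine he (distPoint K D (γ ⊔ D.ρ) (sup_le hγ.le ρ_le)))) :
    closure (idempotentsIn K D γ hγ.le) =
      idempotentsIn K D γ hγ.le ∪ {distPoint K D (γ ⊔ D.ρ) (sup_le hγ.le ρ_le)} := by
  rw [idempotentsIn_eq he hγ hp heγ hfib]
  have hcl := isClosed_fibre (distPoint K D (γ ⊔ D.ρ) (sup_le hγ.le ρ_le))
  have h0 := rootLine_zero he (distPoint K D (γ ⊔ D.ρ) (sup_le hγ.le ρ_le))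
  rw [core_distPoint_sup hγ.le] at h0
  rw [hfib] at hcl
  have hcl0 := rootLine_zero_mem_closure he (distPoint K D (γ ⊔ D.ρ) (sup_le hγ.le ρ_le))
  rw [h0] at hcl0
  refine Set.Subset.antisymm ?_ (Set.union_subset subset_closure (Set.singleton_subset_iff.2 hcl0))
  refine (closure_minimal (Set.image_subset_range _ _) hcl).trans ?_
  rintro _ ⟨s, rfl⟩
  by_cases hs : s = 0
  · right; rw [hs, h0]; rfl
  · exact Or.inl ⟨s, hs, rfl⟩

end ToricMonoid.CorankOneDatum

theorem proposition6p1 {K : Type*} [Field K] [IsAlgClosed K] [CharZero K]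
    {N : Type*} [AddCommGroup N] [Module.Free ℤ N] [Module.Finite ℤ N] (D : CorankOneDatum N) :
    -- the closure of `E_γ`
    (∀ (γ : PointedCone ℚ (NQ N)) (hγ : IsFace γ D.σ), ¬ IsRay D.ρ γ →
      Xor (InPerp D.e₁ γ) (InPerp D.e₂ γ) →
      closure (idempotentsIn K D γ hγ.le) =
        idempotentsIn K D γ hγ.le ∪ {distPoint K D (γ ⊔ D.ρ) (sup_le hγ.le ρ_le)}) ∧
    -- the irreducible components of `E(X)`
    ((idempotentComponents K D).PairwiseDisjoint id ∧
      ∀ C ∈ idempotentComponents K D, (∃ x, C = {x}) ∨ IsAffineLine C) ∧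
    -- the orbits of the group of invertible elements acting on both sides
    ((∀ C ∈ idempotentComponents K D, ∃ x, C ⊆ unitOrbit x) ∧
      ∀ x : Variety K D, ∀ C ∈ idempotentComponents K D, ∀ C' ∈ idempotentComponents K D,
        C ⊆ unitOrbit x → C' ⊆ unitOrbit x → C = C') := by
  refine ⟨fun γ hγ hp hxor => ?_, ⟨?_, ?_⟩, ?_, ?_⟩
  · have hE := distPoint_sup_mem_idempotents (K := K) hγ.le
    have hcore := core_distPoint_sup (K := K) hγ.le
    have hact := fun {e} (he : IsDemazureRoot D.σ D.p e) =>
      active_distPoint_sup_iff (K := K) he hγ hp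
    rcases hxor with ⟨h₁, h₂⟩ | ⟨h₂, h₁⟩
    · refine closure_idempotentsIn D.root₁ hγ hp h₁ ?_
      rw [fibre_eq_range₁ hE (by rwa [hact D.root₂]), hcore]
    · refine closure_idempotentsIn D.root₂ hγ hp h₂ ?_
      rw [fibre_eq_range₂ hE (by rwa [hact D.root₁]), hcore]
  · intro C hC C' hC' hne
    obtain ⟨x, hx, rfl⟩ := exists_eq_fibre hC
    obtain ⟨x', hx', rfl⟩ := exists_eq_fibre hC'
    refine Set.disjoint_left.2 fun z hz hz' => hne ?_
    rw [← fibre_eq_of_mem hz, ← fibre_eq_of_mem hz']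
  · intro C hC
    obtain ⟨x, hx, rfl⟩ := exists_eq_fibre hC
    exact fibre_eq_singleton_or_isAffineLine hx
  · intro C hC
    obtain ⟨x, hx, rfl⟩ := exists_eq_fibre hC
    exact ⟨core x, fibre_subset_unitOrbit hx⟩
  · intro x C hC C' hC' h h'
    obtain ⟨a, ha, rfl⟩ := exists_eq_fibre hC
    obtain ⟨b, hb, rfl⟩ := exists_eq_fibre hC'
    exact fibre_eq_of_mem_unitOrbit ha hb (h (self_mem_fibre ha)) (h' (self_mem_fibre hb))
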